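/- **Theorem 4.1.** Let $N,K$ be integers with $0<K<N$, let $p>0$, and let $\Gamma$ be the star graph made of $N$ half-lines $\mathbb R^+=(0,\infty)$ joined at a vertex, placed at $x=0$, with $L^2(\Gamma)=\bigoplus_{j=1}^N L^2(\mathbb R^+)$ (complex-valued functions). Let $\alpha_1,\dots,\alpha_N>0$ satisfy $$\sum_{j=1}^K \frac1{\alpha_j^{2/p}}=\sum_{j=K+1}^N\frac1{\alpha_j^{2/p}} .$$ Let $H^2_\Gamma$ be the space of all $\Psi=(\psi_1,\dots,\psi_N)$ with $\psi_j\in H^2(\mathbb R^+)$ for every $j$ such that $$\alpha_1^{1/p}\psi_1(0)=\dots=\alpha_N^{1/p}\psi_N(0),\qquad \sum_{j=1}^N\alpha_j^{-1/p}\psi_j'(0)=0 ,$$ and let $\Delta:H^2_\Gamma\subset L^2(\Gamma)\to L^2(\Gamma)$ be the Laplacian $(\Delta\Psi)_j=\psi_j''$. Let $\phi(x)=\operatorname{sech}^{1/p}(px)$, let $a\in\mathbb R$ with $a\neq0$, and let $\Phi=(\phi_1,\dots,\phi_N)$ be the shifted state $$\phi_j(x)=\begin{cases}\alpha_j^{-1/p}\phi(x+a),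 & 1\le j\le K,\\ \alpha_j^{-1/p}\phi(x-a), & K+1\le j\le N.\end{cases}$$ Let $\alpha$ be the function equal to $\alpha_j$ on the $j$-th edge, and define, with domain $H^2_\Gamma$ in $L^2(\Gamma)$, $$L_+=-\Delta+1-(2p+1)(p+1)\alpha^2\Phi^{2p},\qquad L_-=-\Delta+1-(p+1)\alpha^2\Phi^{2p}.$$ Write $\sigma_p$ for the set of (complex) eigenvalues and call $\dim\ker(L-\lambda)$ the multiplicity of $\lambda$ (multiplicity $0$ means that $\lambda$ is not an eigenvalue); an eigenvalue of multiplicity $1$ is called simple. Then: 1. $\sigma_p(L_-)\subset[0,\infty)$, and $0$ is a simple eigenvalue of $L_-$. Moreover there is $\delta>0$ with $\sigma_p(L_-)\setminus\{0\}\subset[\delta,\infty)$. 2. There are real numbers $\lambda_0<\lambda_1<0$ such that $\lambda_0$ is a simple eigenvalue of $L_+$; $\lambda_1$ has multiplicity $K-1$ for $L_+$ if $a<0$, and multiplicity $N-K-1$ if $a>0$; and $0$ is a simple eigenvalue of $L_+$. Moreover there is $\delta>0$ with $\sigma_p(L_+)\setminus\{\lambda_0,\lambda_1,0\}\subset[\delta,\infty)$.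 -/

import Mathlib

open MeasureTheory Set
open scoped BoundedContinuousFunction

noncomputable section

namespace StarGraph

/-! ### Sobolev spaces on the half-line -/

/-- The complex Hilbert space `L²(ℝ⁺)` of one edge. -/
abbrev L2Edge : Type := Lp ℂ 2 (volume.restrict (Ioi (0 : ℝ)))

/-- `u ∈ L²(ℝ⁺)` agrees almost everywhere with the absolutely continuous function
`x ↦ b + ∫₀ˣ v` on `[0, ∞)`, where `v ∈ L²(ℝ⁺)`: that is, `u ∈ H¹(ℝ⁺)`, with weak derivative
`u' = v` and boundary value `u(0) = b`. -/
def IsPrimitive (b : ℂ) (v u : L2Edge) : Prop :=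
  ∀ᵐ x ∂(volume.restrict (Ioi (0 : ℝ))), u x = b + ∫ t in (0 : ℝ)..x, v t

theorem intervalIntegrable_edge (v : L2Edge) {x : ℝ} (hx : 0 < x) :
    IntervalIntegrable (fun t => v t) volume 0 x := by
  rw [intervalIntegrable_iff_integrableOn_Ioc_of_le hx.le]
  have h1 : MemLp (fun t => v t) 2 (volume.restrict (Ioc 0 x)) :=
    (Lp.memLp v).mono_measure (Measure.restrict_mono Ioc_subset_Ioi_self le_rfl)
  exact h1.integrable (by norm_num)

theorem isPrimitive_zero : IsPrimitive 0 0 0 := by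
  have h0 := Lp.coeFn_zero (E := ℂ) (p := 2) (μ := volume.restrict (Ioi (0 : ℝ)))
  filter_upwards [h0, ae_restrict_mem measurableSet_Ioi] with x hx hx0
  rw [hx]
  have : ∫ t in (0 : ℝ)..x, (0 : L2Edge) t = ∫ t in (0 : ℝ)..x, (0 : ℂ) := by
    apply intervalIntegral.integral_congr_ae
    rw [uIoc_of_le (le_of_lt hx0), ← ae_restrict_iff' measurableSet_Ioc]
    exact ae_restrict_of_ae_restrict_of_subset Ioc_subset_Ioi_self h0
  rw [this]
  simp

theorem IsPrimitive.add {b b' : ℂ} {v v' u u' : L2Edge} (h : IsPrimitive b v u)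
    (h' : IsPrimitive b' v' u') : IsPrimitive (b + b') (v + v') (u + u') := by
  have hv := Lp.coeFn_add v v'
  filter_upwards [h, h', Lp.coeFn_add u u', ae_restrict_mem measurableSet_Ioi]
    with x hx hx' hu hx0
  have hx0 : (0 : ℝ) < x := hx0
  have : ∫ t in (0 : ℝ)..x, (v + v') t = ∫ t in (0 : ℝ)..x, (v t + v' t) := by
    apply intervalIntegral.integral_congr_ae
    rw [uIoc_of_le hx0.le, ← ae_restrict_iff' measurableSet_Ioc]
    exact ae_restrict_of_ae_restrict_of_subset Ioc_subset_Ioi_self hv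
  rw [hu, Pi.add_apply, hx, hx', this, intervalIntegral.integral_add
    (intervalIntegrable_edge v hx0) (intervalIntegrable_edge v' hx0)]
  ring

theorem IsPrimitive.smul (c : ℂ) {b : ℂ} {v u : L2Edge} (h : IsPrimitive b v u) :
    IsPrimitive (c * b) (c • v) (c • u) := by
  have hv := Lp.coeFn_smul c v
  filter_upwards [h, Lp.coeFn_smul c u, ae_restrict_mem measurableSet_Ioi] with x hx hu hx0
  have hx0 : (0 : ℝ) < x := hx0
  have : ∫ t in (0 : ℝ)..x, (c • v) t = ∫ t in (0 : ℝ)..x, c • v t := by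
    apply intervalIntegral.integral_congr_ae
    rw [uIoc_of_le hx0.le, ← ae_restrict_iff' measurableSet_Ioc]
    exact ae_restrict_of_ae_restrict_of_subset Ioc_subset_Ioi_self hv
  rw [hu, Pi.smul_apply, hx, this, intervalIntegral.integral_smul, smul_add]
  simp

theorem IsPrimitive.eq_zero {b : ℂ} {v : L2Edge} (h : IsPrimitive b v 0) : b = 0 ∧ v = 0 := by
  have hloc : LocallyIntegrable (indicator (Ioi (0 : ℝ)) (fun t => v t)) volume := by
    have : MemLp (indicator (Ioi (0 : ℝ)) (fun t => v t)) 2 volume :=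
      (memLp_indicator_iff_restrict measurableSet_Ioi).2 (Lp.memLp v)
    exact this.locallyIntegrable (by norm_num)
  set w := indicator (Ioi (0 : ℝ)) (fun t => v t) with hw
  have hii : ∀ x y : ℝ, IntervalIntegrable w volume x y := fun x y =>
    (hloc.integrableOn_isCompact isCompact_uIcc).intervalIntegrable
  have hcont : Continuous (fun x : ℝ => b + ∫ t in (0 : ℝ)..x, w t) :=
    continuous_const.add (intervalIntegral.continuous_primitive hii 0)
  have hae : (fun x : ℝ => b + ∫ t in (0 : ℝ)..x, w t)
      =ᵐ[volume.restrict (Ioi (0 : ℝ))] fun _ => (0 : ℂ) := by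
    filter_upwards [h, Lp.coeFn_zero (E := ℂ) (p := 2) (μ := volume.restrict (Ioi (0 : ℝ))),
      ae_restrict_mem measurableSet_Ioi] with x hx h0 hx0
    have hx0 : (0 : ℝ) < x := hx0
    rw [h0] at hx
    have : ∫ t in (0 : ℝ)..x, w t = ∫ t in (0 : ℝ)..x, v t := by
      apply intervalIntegral.integral_congr_ae
      refine Filter.Eventually.of_forall fun t ht => ?_
      rw [uIoc_of_le hx0.le] at ht
      exact indicator_of_mem (show t ∈ Ioi (0 : ℝ) from ht.1) _
    rw [this, ← hx]
    rfl
  have hEq : EqOn (fun x : ℝ => b + ∫ t in (0 : ℝ)..x, w t) (fun _ => (0 : ℂ)) (Ioi 0) :=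
    Measure.eqOn_open_of_ae_eq hae isOpen_Ioi hcont.continuousOn continuousOn_const
  have hb : b = 0 := by
    have := hEq.closure hcont continuous_const
    rw [closure_Ioi] at this
    simpa using this (self_mem_Ici (a := (0 : ℝ)))
  refine ⟨hb, ?_⟩
  have hd := LocallyIntegrable.ae_hasDerivAt_integral hloc
  apply Lp.ext
  filter_upwards [ae_restrict_of_ae hd, ae_restrict_mem measurableSet_Ioi,
    Lp.coeFn_zero (E := ℂ) (p := 2) (μ := volume.restrict (Ioi (0 : ℝ)))] with x hx hx0 h0
  have h1 : HasDerivAt (fun y : ℝ => ∫ t in (0 : ℝ)..y, w t) (w x) x := hx 0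
  have h2 : HasDerivAt (fun _ : ℝ => (0 : ℂ)) (w x) x := by
    refine h1.congr_of_eventuallyEq ?_
    filter_upwards [isOpen_Ioi.mem_nhds hx0] with y hy
    have := hEq hy
    simpa [hb] using this.symm
  have h3 : w x = 0 := h2.unique (hasDerivAt_const x (0 : ℂ))
  rw [h0]
  rw [hw, indicator_of_mem hx0] at h3
  exact h3

theorem IsPrimitive.unique {b b' : ℂ} {v v' u : L2Edge} (h : IsPrimitive b v u)
    (h' : IsPrimitive b' v' u) : b = b' ∧ v = v' := by
  have h0 := h.add (h'.smul (-1))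
  have hu : u + (-1 : ℂ) • u = 0 := by simp
  rw [hu] at h0
  obtain ⟨h1, h2⟩ := h0.eq_zero
  refine ⟨?_, ?_⟩
  · linear_combination h1
  · rw [neg_one_smul, ← sub_eq_add_neg, sub_eq_zero] at h2
    exact h2

/-- The Sobolev space `H¹(ℝ⁺)`. -/
def H1Edge : Submodule ℂ L2Edge where
  carrier := {u | ∃ b v, IsPrimitive b v u}
  add_mem' := by
    rintro u u' ⟨b, v, h⟩ ⟨b', v', h'⟩
    exact ⟨_, _, h.add h'⟩
  zero_mem' := ⟨0, 0, isPrimitive_zero⟩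
  smul_mem' := by
    rintro c u ⟨b, v, h⟩
    exact ⟨_, _, h.smul c⟩

open Classical in
/-- The boundary value `u(0)` of `u ∈ H¹(ℝ⁺)` (and `0` if `u ∉ H¹(ℝ⁺)`). -/
def trace (u : L2Edge) : ℂ :=
  if h : ∃ b v, IsPrimitive b v u then h.choose else 0

open Classical in
/-- The weak derivative `u'` of `u ∈ H¹(ℝ⁺)` (and `0` if `u ∉ H¹(ℝ⁺)`). -/
def weakDeriv (u : L2Edge) : L2Edge :=
  if h : ∃ b v, IsPrimitive b v u then h.choose_spec.choose else 0

theorem isPrimitive_of_mem {u : L2Edge} (h : u ∈ H1Edge) :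
    IsPrimitive (trace u) (weakDeriv u) u := by
  have h' : ∃ b v, IsPrimitive b v u := h
  rw [trace, weakDeriv, dif_pos h', dif_pos h']
  exact h'.choose_spec.choose_spec

theorem IsPrimitive.trace_eq {b : ℂ} {v u : L2Edge} (h : IsPrimitive b v u) : trace u = b :=
  ((isPrimitive_of_mem ⟨b, v, h⟩).unique h).1

theorem IsPrimitive.weakDeriv_eq {b : ℂ} {v u : L2Edge} (h : IsPrimitive b v u) :
    weakDeriv u = v :=
  ((isPrimitive_of_mem ⟨b, v, h⟩).unique h).2

theorem trace_zero : trace 0 = 0 := isPrimitive_zero.trace_eq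

theorem weakDeriv_zero : weakDeriv 0 = 0 := isPrimitive_zero.weakDeriv_eq

theorem trace_add {u u' : L2Edge} (h : u ∈ H1Edge) (h' : u' ∈ H1Edge) :
    trace (u + u') = trace u + trace u' :=
  ((isPrimitive_of_mem h).add (isPrimitive_of_mem h')).trace_eq

theorem weakDeriv_add {u u' : L2Edge} (h : u ∈ H1Edge) (h' : u' ∈ H1Edge) :
    weakDeriv (u + u') = weakDeriv u + weakDeriv u' :=
  ((isPrimitive_of_mem h).add (isPrimitive_of_mem h')).weakDeriv_eq

theorem trace_smul (c : ℂ) {u : L2Edge} (h : u ∈ H1Edge) : trace (c • u) = c * trace u :=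
  ((isPrimitive_of_mem h).smul c).trace_eq

theorem weakDeriv_smul (c : ℂ) {u : L2Edge} (h : u ∈ H1Edge) :
    weakDeriv (c • u) = c • weakDeriv u :=
  ((isPrimitive_of_mem h).smul c).weakDeriv_eq

/-- The Sobolev space `H²(ℝ⁺)`. -/
def H2Edge : Submodule ℂ L2Edge where
  carrier := {u | u ∈ H1Edge ∧ weakDeriv u ∈ H1Edge}
  add_mem' := by
    rintro u u' ⟨h1, h2⟩ ⟨h1', h2'⟩
    refine ⟨add_mem h1 h1', ?_⟩
    rw [weakDeriv_add h1 h1']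
    exact add_mem h2 h2'
  zero_mem' := by
    refine ⟨zero_mem _, ?_⟩
    rw [weakDeriv_zero]
    exact zero_mem _
  smul_mem' := by
    rintro c u ⟨h1, h2⟩
    refine ⟨H1Edge.smul_mem c h1, ?_⟩
    rw [weakDeriv_smul c h1]
    exact H1Edge.smul_mem c h2

/-! ### The star graph with `N` edges -/

/-- The complex Hilbert space `L²(Γ) = ⊕ⱼ L²(ℝ⁺)`. -/
abbrev L2Graph (N : ℕ) : Type := PiLp 2 (fun _ : Fin N => L2Edge)

/-- The space `H¹_Γ`: componentwise `H¹` and `αᵢ^(1/p) ψᵢ(0) = αⱼ^(1/p) ψⱼ(0)` for all `i, j`. -/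
def H1Graph {N : ℕ} (p : ℝ) (α : Fin N → ℝ) : Submodule ℂ (L2Graph N) where
  carrier := {Ψ | (∀ j, Ψ j ∈ H1Edge) ∧
    ∀ i j, ((α i ^ (1 / p) : ℝ) : ℂ) * trace (Ψ i) = ((α j ^ (1 / p) : ℝ) : ℂ) * trace (Ψ j)}
  add_mem' := by
    rintro Ψ Ψ' ⟨h1, h2⟩ ⟨h1', h2'⟩
    refine ⟨fun j => add_mem (h1 j) (h1' j), fun i j => ?_⟩
    rw [PiLp.add_apply, PiLp.add_apply, trace_add (h1 i) (h1' i), trace_add (h1 j) (h1' j),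
      mul_add, mul_add, h2 i j, h2' i j]
  zero_mem' := by
    refine ⟨fun j => zero_mem _, fun i j => ?_⟩
    simp [trace_zero]
  smul_mem' := by
    rintro c Ψ ⟨h1, h2⟩
    refine ⟨fun j => H1Edge.smul_mem c (h1 j), fun i j => ?_⟩
    rw [PiLp.smul_apply, PiLp.smul_apply, trace_smul c (h1 i), trace_smul c (h1 j),
      mul_left_comm, h2 i j, mul_left_comm]

/-- The space `H²_Γ`: componentwise `H²`, the continuity conditions of `H¹_Γ`, and the
generalized Kirchhoff condition `∑ⱼ αⱼ^(-1/p) ψⱼ'(0) = 0`. -/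
def H2Graph {N : ℕ} (p : ℝ) (α : Fin N → ℝ) : Submodule ℂ (L2Graph N) where
  carrier := {Ψ | (∀ j, Ψ j ∈ H2Edge) ∧ Ψ ∈ H1Graph p α ∧
    ∑ j, ((1 / α j ^ (1 / p) : ℝ) : ℂ) * trace (weakDeriv (Ψ j)) = 0}
  add_mem' := by
    rintro Ψ Ψ' ⟨h1, h2, h3⟩ ⟨h1', h2', h3'⟩
    refine ⟨fun j => add_mem (h1 j) (h1' j), add_mem h2 h2', ?_⟩
    have : ∀ j, trace (weakDeriv ((Ψ + Ψ') j))
        = trace (weakDeriv (Ψ j)) + trace (weakDeriv (Ψ' j)) := fun j => by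
      rw [PiLp.add_apply, weakDeriv_add (h1 j).1 (h1' j).1, trace_add (h1 j).2 (h1' j).2]
    simp_rw [this, mul_add]
    rw [Finset.sum_add_distrib, h3, h3', add_zero]
  zero_mem' := by
    refine ⟨fun j => zero_mem _, zero_mem _, ?_⟩
    simp [weakDeriv_zero, trace_zero]
  smul_mem' := by
    rintro c Ψ ⟨h1, h2, h3⟩
    refine ⟨fun j => H2Edge.smul_mem c (h1 j), Submodule.smul_mem _ c h2, ?_⟩
    have : ∀ j, trace (weakDeriv ((c • Ψ) j)) = c * trace (weakDeriv (Ψ j)) := fun j => by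
      rw [PiLp.smul_apply, weakDeriv_smul c (h1 j).1, trace_smul c (h1 j).2]
    simp_rw [this, mul_left_comm _ c]
    rw [← Finset.mul_sum, h3, mul_zero]

/-- The Laplacian `Δ : H²_Γ ⊂ L²(Γ) → L²(Γ)`, `(ΔΨ)ⱼ = ψⱼ''`. -/
def laplacian {N : ℕ} (p : ℝ) (α : Fin N → ℝ) : L2Graph N →ₗ.[ℂ] L2Graph N where
  domain := H2Graph p α
  toFun :=
    { toFun := fun Ψ => WithLp.toLp 2 fun j => weakDeriv (weakDeriv (Ψ.1 j))
      map_add' := by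
        rintro ⟨Ψ, h⟩ ⟨Ψ', h'⟩
        ext1 j
        change weakDeriv (weakDeriv (Ψ j + Ψ' j))
          = weakDeriv (weakDeriv (Ψ j)) + weakDeriv (weakDeriv (Ψ' j))
        rw [weakDeriv_add (h.1 j).1 (h'.1 j).1, weakDeriv_add (h.1 j).2 (h'.1 j).2]
      map_smul' := by
        rintro c ⟨Ψ, h⟩
        ext1 j
        change weakDeriv (weakDeriv (c • Ψ j)) = c • weakDeriv (weakDeriv (Ψ j))
        rw [weakDeriv_smul c (h.1 j).1, weakDeriv_smul c (h.1 j).2] }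

theorem memLp_mul (g : ℝ →ᵇ ℝ) (u : L2Edge) :
    MemLp (fun x => (g x : ℂ) * u x) 2 (volume.restrict (Ioi (0 : ℝ))) := by
  refine (Lp.memLp u).of_le_mul (c := ‖g‖)
    (((Complex.continuous_ofReal.comp g.continuous).aestronglyMeasurable).mul
      (Lp.aestronglyMeasurable u)) (Filter.Eventually.of_forall fun x => ?_)
  rw [norm_mul, Complex.norm_real]
  exact mul_le_mul_of_nonneg_right (g.norm_coe_le_norm x) (norm_nonneg _)

/-- Multiplication by a bounded continuous real function on `L²(ℝ⁺)`. -/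
def mulEdge (g : ℝ →ᵇ ℝ) : L2Edge →ₗ[ℂ] L2Edge where
  toFun u := (memLp_mul g u).toLp _
  map_add' u u' := by
    rw [← MemLp.toLp_add]
    apply MemLp.toLp_congr
    filter_upwards [Lp.coeFn_add u u'] with x hx
    rw [hx, Pi.add_apply, Pi.add_apply, mul_add]
  map_smul' c u := by
    rw [RingHom.id_apply, ← MemLp.toLp_const_smul]
    apply MemLp.toLp_congr
    filter_upwards [Lp.coeFn_smul c u] with x hx
    rw [hx, Pi.smul_apply, Pi.smul_apply, smul_eq_mul, smul_eq_mul, mul_left_comm]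

/-- Multiplication by a bounded potential on `L²(Γ)`, given edge by edge. -/
def mulGraph {N : ℕ} (V : Fin N → (ℝ →ᵇ ℝ)) : L2Graph N →ₗ[ℂ] L2Graph N where
  toFun Ψ := WithLp.toLp 2 fun j => mulEdge (V j) (Ψ j)
  map_add' Ψ Ψ' := by
    ext1 j
    exact map_add (mulEdge (V j)) (Ψ j) (Ψ' j)
  map_smul' c Ψ := by
    ext1 j
    exact map_smul (mulEdge (V j)) c (Ψ j)

/-- The operator `-Δ + 1 - c V : H²_Γ ⊂ L²(Γ) → L²(Γ)`. -/
def hessian {N : ℕ} (p : ℝ) (α : Fin N → ℝ) (c : ℝ) (V : Fin N → (ℝ →ᵇ ℝ)) :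
    L2Graph N →ₗ.[ℂ] L2Graph N where
  domain := (laplacian p α).domain
  toFun := -(laplacian p α).toFun
    + (LinearMap.id - (c : ℂ) • mulGraph V).comp (laplacian p α).domain.subtype

/-! ### The shifted states and their Hessian operators -/

/-- The soliton profile `φ(x) = sech^(1/p)(p x)`. -/
def soliton (p x : ℝ) : ℝ := (1 / Real.cosh (p * x)) ^ (1 / p)

/-- The shifted state: `αⱼ^(-1/p) φ(x + a)` on the first `K` (incoming) edges and
`αⱼ^(-1/p) φ(x - a)` on the remaining `N - K` (outgoing) edges. -/
def shiftedState {N : ℕ} (K : ℕ) (p : ℝ) (α : Fin N → ℝ) (a : ℝ) (j : Fin N) (x : ℝ) : ℝ :=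
  α j ^ (-1 / p) * (if (j : ℕ) < K then soliton p (x + a) else soliton p (x - a))

theorem soliton_pos (p x : ℝ) : 0 < soliton p x :=
  Real.rpow_pos_of_pos (one_div_pos.2 (Real.cosh_pos _)) _

theorem soliton_le_one {p : ℝ} (hp : 0 < p) (x : ℝ) : soliton p x ≤ 1 :=
  Real.rpow_le_one (one_div_pos.2 (Real.cosh_pos _)).le
    ((div_le_one (Real.cosh_pos _)).2 (Real.one_le_cosh _)) (one_div_pos.2 hp).le

theorem continuous_soliton (p : ℝ) : Continuous (soliton p) := by
  have h : Continuous fun x : ℝ => 1 / Real.cosh (p * x) :=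
    continuous_const.div (Real.continuous_cosh.comp (continuous_const.mul continuous_id))
      fun x => (Real.cosh_pos _).ne'
  exact h.rpow_const fun x => Or.inl (one_div_pos.2 (Real.cosh_pos _)).ne'

theorem shiftedState_pos {N : ℕ} (K : ℕ) (p : ℝ) {α : Fin N → ℝ} (hα : ∀ j, 0 < α j) (a : ℝ)
    (j : Fin N) (x : ℝ) : 0 < shiftedState K p α a j x := by
  unfold shiftedState
  refine mul_pos (Real.rpow_pos_of_pos (hα j) _) ?_
  split_ifs <;> exact soliton_pos _ _

theorem shiftedState_le {N : ℕ} (K : ℕ) {p : ℝ} (hp : 0 < p) {α : Fin N → ℝ}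
    (hα : ∀ j, 0 < α j) (a : ℝ) (j : Fin N) (x : ℝ) :
    shiftedState K p α a j x ≤ α j ^ (-1 / p) := by
  unfold shiftedState
  refine mul_le_of_le_one_right (Real.rpow_pos_of_pos (hα j) _).le ?_
  split_ifs <;> exact soliton_le_one hp _

theorem continuous_shiftedState {N : ℕ} (K : ℕ) (p : ℝ) (α : Fin N → ℝ) (a : ℝ) (j : Fin N) :
    Continuous (shiftedState K p α a j) := by
  unfold shiftedState
  refine continuous_const.mul ?_
  split_ifs
  · exact (continuous_soliton p).comp (continuous_id.add continuous_const)
  · exact (continuous_soliton p).comp (continuous_id.sub continuous_const)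

/-- The potential `α² Φ^(2p)` of the shifted state `Φ`, as a bounded continuous function on each
edge. -/
def shiftedPotential {N : ℕ} (K : ℕ) {p : ℝ} (hp : 0 < p) {α : Fin N → ℝ} (hα : ∀ j, 0 < α j)
    (a : ℝ) (j : Fin N) : ℝ →ᵇ ℝ :=
  BoundedContinuousFunction.ofNormedAddCommGroup
    (fun x => α j ^ 2 * shiftedState K p α a j x ^ (2 * p))
    (continuous_const.mul ((continuous_shiftedState K p α a j).rpow_const
      fun x => Or.inl (shiftedState_pos K p hα a j x).ne'))
    (α j ^ 2 * (α j ^ (-1 / p)) ^ (2 * p))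
    (fun x => by
      have h := shiftedState_pos K p hα a j x
      rw [Real.norm_of_nonneg (mul_nonneg (sq_nonneg _) (Real.rpow_nonneg h.le _))]
      exact mul_le_mul_of_nonneg_left
        (Real.rpow_le_rpow h.le (shiftedState_le K hp hα a j x) (by positivity)) (sq_nonneg _))

/-- `L₊ = -Δ + 1 - (2p + 1)(p + 1) α² Φ^(2p)` for the shifted state `Φ`. -/
def Lplus {N : ℕ} (K : ℕ) {p : ℝ} (hp : 0 < p) {α : Fin N → ℝ} (hα : ∀ j, 0 < α j) (a : ℝ) :
    L2Graph N →ₗ.[ℂ] L2Graph N :=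
  hessian p α ((2 * p + 1) * (p + 1)) (shiftedPotential K hp hα a)

/-- `L₋ = -Δ + 1 - (p + 1) α² Φ^(2p)` for the shifted state `Φ`. -/
def Lminus {N : ℕ} (K : ℕ) {p : ℝ} (hp : 0 < p) {α : Fin N → ℝ} (hα : ∀ j, 0 < α j) (a : ℝ) :
    L2Graph N →ₗ.[ℂ] L2Graph N :=
  hessian p α (p + 1) (shiftedPotential K hp hα a)

/-! ### Eigenvalues of a partially defined operator -/

/-- The eigenspace `ker (T - z) ⊆ dom T` of a partially defined operator. -/
def eigenspace {E : Type*} [AddCommGroup E] [Module ℂ E] (T : E →ₗ.[ℂ] E) (z : ℂ) :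
    Submodule ℂ T.domain :=
  LinearMap.ker (T.toFun - z • T.domain.subtype)

/-- The point spectrum `σ_p(T)`: the set of all eigenvalues. -/
def pointSpectrum {E : Type*} [AddCommGroup E] [Module ℂ E] (T : E →ₗ.[ℂ] E) : Set ℂ :=
  {z | eigenspace T z ≠ ⊥}

/-- The eigenspace of `T` at `z` has dimension `m` (so that `z` is an eigenvalue of multiplicity
`m` if `m ≠ 0`, and not an eigenvalue if `m = 0`). -/
def HasMultiplicity {E : Type*} [AddCommGroup E] [Module ℂ E] (T : E →ₗ.[ℂ] E) (z : ℂ)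
    (m : ℕ) : Prop :=
  Module.rank ℂ (eigenspace T z) = m

end StarGraph

end

/-! On every edge the potential `α² Φ^(2p)` is `sech² (p (x ± a))`: the weights cancel and only the
shift remembers the edge. For an eigenvalue `λ = 1 - p² κ²` below `1`, with `κ > 0`, put `y = p (x ±
a)`. The eigenvalue equation becomes the Pöschl–Teller equation `U'' = (κ² - s (s + 1) sech² y) U`,
with `s = 1/p` for `L₋` and `s = 1 + 1/p` for `L₊`. Its decaying solutions form a line spanned by
`jost`, which is `sech^κ y` times a hypergeometric function of `(1 - tanh y) / 2`. An eigenvector is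
thus a choice of amplitudes on the edges, and multiplicities become finite linear algebra at the
vertex (`rank_eigenspace_hessian`).

Let `P` be the set of edges whose variable starts at `-B`, the other edges starting at `B`. If
`U(B)` and `U(-B)` are both non-zero, continuity leaves one free amplitude. The balance of the
weights then turns the Kirchhoff condition into `U(B) U'(-B) + U'(B) U(-B) = 0`. The left side is a
Wronskian of `U(y)` and `U(-y)`, hence constant in `B` and equal to `2 U(0) U'(0)`. So these
eigenvalues do not depend on the shift, and they are simple: they occur when `U'(0) = 0` (even
states on the line) or `U(0) = 0` (odd states). If instead `U(-B) = 0` while `U(B)` and `U'(-B)` are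
non-zero, all amplitudes off `P` vanish and those on `P` satisfy one linear equation, which gives
multiplicity `|P| - 1`.

It remains to locate zeros in `κ`, which `exists_gap_ground` and `exists_gap_excited` do by
positivity of hypergeometric series, continuity in `κ` and Sturm comparison. Down to slightly below
`κ = s`, only `U'(0)` vanishes, and only at `κ = s`: this is the eigenvalue `0` of `L₋`. Down to
slightly below `κ = s - 1` with `B > 0`, `U'(0)` vanishes only at `s`, `U(0)` only at `s - 1`, and
`U(-B)` only at one `κ₁` strictly between: these are `λ₀`, `0` and `λ₁` for `L₊`. Stopping slightly
below the last zero yields the gap `δ`. Non-real eigenvalues are excluded beforehand by Green's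
formula. -/

noncomputable section

namespace StarGraph

/-! ### The Gauss hypergeometric series on `(-1, 1)` -/

/-- Coefficients of the Gauss hypergeometric series. -/
def hypCoeff (a b c : ℝ) : ℕ → ℝ
  | 0 => 1
  | n + 1 => hypCoeff a b c n * ((a + n) * (b + n) / ((c + n) * (n + 1)))

/-- The Gauss hypergeometric function `₂F₁(a, b; c; x)`. -/
def hyp (a b c x : ℝ) : ℝ := ∑' n, hypCoeff a b c n * x ^ n

theorem hypCoeff_pos {a b c : ℝ} (ha : 0 < a) (hb : 0 < b) (hc : 0 < c) (n : ℕ) :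
    0 < hypCoeff a b c n := by
  induction n with
  | zero => exact one_pos
  | succ n ih => rw [hypCoeff]; positivity

/-- A majorant with positive parameters, uniform over bounded `a`, `b` and over `c` bounded below.
It makes convergence locally uniform both in the variable and in the parameters. -/
theorem abs_hypCoeff_le {a b c M m : ℝ} (ha : |a| ≤ M) (hb : |b| ≤ M) (hm : 0 < m) (hc : m ≤ c)
    (n : ℕ) : |hypCoeff a b c n| ≤ hypCoeff M M m n := by
  induction n with
  | zero => simp [hypCoeff]
  | succ n ih =>
    have hc0 : 0 < c + n := by have := hm.trans_le hc; positivity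
    have key : ∀ t : ℝ, |t| ≤ M → |t + n| ≤ M + n := fun t ht =>
      (abs_add_le _ _).trans (by rw [Nat.abs_cast]; gcongr)
    have hM : 0 ≤ M := (abs_nonneg a).trans ha
    rw [hypCoeff, hypCoeff, abs_mul, abs_div, abs_mul,
      abs_of_pos (show 0 < (c + n) * ((n : ℝ) + 1) by positivity)]
    have h1 := key a ha
    have h2 := key b hb
    have := (abs_nonneg _).trans ih
    gcongr

/-- The reason why the derivative of a hypergeometric series is again hypergeometric, with all three
parameters raised by one. -/
theorem hypCoeff_shift {a b c : ℝ} (hc : 0 < c) (n : ℕ) :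
    (n + 1) * hypCoeff a b c (n + 1)
      = a * b / c * hypCoeff (a + 1) (b + 1) (c + 1) n := by
  induction n with
  | zero => simp [hypCoeff]
  | succ n ih =>
    have h1 : c + n + 1 ≠ 0 := by positivity
    have h2 : (n : ℝ) + 1 ≠ 0 := by positivity
    have h3 : (n : ℝ) + 2 ≠ 0 := by positivity
    have e1 : hypCoeff a b c (n + 1 + 1)
      = hypCoeff a b c (n + 1) * ((a + n + 1) * (b + n + 1) / ((c + n + 1) * (n + 2))) := by
      rw [hypCoeff]; push_cast; ring_nf
    have e2 : hypCoeff (a + 1) (b + 1) (c + 1) (n + 1) = hypCoeff (a + 1) (b + 1) (c + 1) n *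
        ((a + n + 1) * (b + n + 1) / ((c + n + 1) * (n + 1))) := by
      rw [hypCoeff]; ring_nf
    rw [e1, e2, ← mul_assoc (a * b / c), ← ih]
    push_cast
    field_simp
    ring

theorem summable_hypCoeff_mul_pow {a b c x : ℝ} (ha : 0 < a) (hb : 0 < b) (hc : 0 < c)
    (hx0 : 0 ≤ x) (hx1 : x < 1) : Summable fun n => hypCoeff a b c n * x ^ n := by
  rcases hx0.eq_or_lt with rfl | hx0
  · refine summable_of_ne_finset_zero (s := {0}) fun n hn => ?_
    rw [zero_pow (by simpa using hn), mul_zero]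
  refine summable_of_ratio_test_tendsto_lt_one hx1 (Filter.Eventually.of_forall fun n =>
    (mul_pos (hypCoeff_pos ha hb hc n) (pow_pos hx0 n)).ne') ?_
  have hlim : ∀ t : ℝ, Filter.Tendsto (fun n : ℕ => t / (n : ℝ)) Filter.atTop (nhds 0) :=
    fun t => tendsto_const_div_atTop_nhds_zero_nat t
  have h : Filter.Tendsto (fun n : ℕ => (a / n + 1) * (b / n + 1) / ((c / n + 1) * (1 / n + 1)) * x)
      Filter.atTop (nhds ((0 + 1) * (0 + 1) / ((0 + 1) * (0 + 1)) * x)) :=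
    ((((hlim a).add_const 1).mul ((hlim b).add_const 1)).div
      (((hlim c).add_const 1).mul ((hlim 1).add_const 1)) (by norm_num)).mul_const x
  simp only [zero_add, mul_one, div_one, one_mul] at h
  refine h.congr' ?_
  filter_upwards [Filter.eventually_gt_atTop 0] with n hn
  have hn' : (0 : ℝ) < n := by exact_mod_cast hn
  have hp := hypCoeff_pos ha hb hc n
  rw [Real.norm_of_nonneg (mul_pos (hypCoeff_pos ha hb hc _) (pow_pos hx0 _)).le,
    Real.norm_of_nonneg (mul_pos hp (pow_pos hx0 _)).le, hypCoeff]
  field_simp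
  ring

theorem hyp_bound {M m r : ℝ} (hM : 0 < M) (hm : 0 < m)
    {a b c x : ℝ} (ha : |a| ≤ M) (hb : |b| ≤ M) (hc : m ≤ c) (hx : |x| ≤ r) (n : ℕ) :
    ‖hypCoeff a b c n * x ^ n‖ ≤ hypCoeff M M m n * r ^ n := by
  rw [norm_mul, norm_pow, Real.norm_eq_abs, Real.norm_eq_abs]
  have := abs_hypCoeff_le ha hb hm hc n
  have := (hypCoeff_pos hM hM hm n).le
  gcongr

theorem summable_hyp {a b c x : ℝ} (hc : 0 < c) (hx : |x| < 1) :
    Summable fun n => hypCoeff a b c n * x ^ n := by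
  have hM : 0 < |a| + |b| + 1 := by positivity
  refine Summable.of_norm_bounded (summable_hypCoeff_mul_pow hM hM hc (abs_nonneg x) hx)
    fun n => hyp_bound hM hc ?_ ?_ le_rfl le_rfl n
  · linarith [abs_nonneg b]
  · linarith [abs_nonneg a]

theorem continuous_hypCoeff {X : Type*} [TopologicalSpace X] {a b c : X → ℝ} (ha : Continuous a)
    (hb : Continuous b) (hc : Continuous c) (hpos : ∀ t, 0 < c t) (n : ℕ) :
    Continuous fun t => hypCoeff (a t) (b t) (c t) n := by
  induction n with
  | zero => exact continuous_const
  | succ n ih =>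
    simp only [hypCoeff]
    refine ih.mul (Continuous.div (by fun_prop) (by fun_prop) fun t => ?_)
    have := hpos t
    positivity

/-- The hypergeometric function depends continuously on its parameters. -/
theorem continuous_hyp_param {X : Type*} [TopologicalSpace X] {a b c : X → ℝ}
    (ha : Continuous a) (hb : Continuous b) (hc : Continuous c) (hpos : ∀ t, 0 < c t)
    {x : ℝ} (hx : |x| < 1) : Continuous fun t => hyp (a t) (b t) (c t) x := by
  rw [continuous_iff_continuousAt]
  intro t₀
  set M := |a t₀| + |b t₀| + 1
  have hM : 0 < M := by positivity
  have hm : 0 < c t₀ / 2 := half_pos (hpos t₀)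
  have hS := summable_hypCoeff_mul_pow hM hM hm (abs_nonneg x) hx
  -- On this neighbourhood of `t₀` one summable series dominates all the others.
  have hmem : {t | |a t| < M ∧ |b t| < M ∧ c t₀ / 2 < c t} ∈ nhds t₀ := by
    refine Filter.inter_mem ?_ (Filter.inter_mem ?_ ?_)
    · exact ha.abs.continuousAt.eventually_lt continuousAt_const
        (by simp only [M]; linarith [abs_nonneg (b t₀)])
    · exact hb.abs.continuousAt.eventually_lt continuousAt_const
        (by simp only [M]; linarith [abs_nonneg (a t₀)])
    · exact continuousAt_const.eventually_lt hc.continuousAt (half_lt_self (hpos t₀))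
  refine ContinuousOn.continuousAt (continuousOn_tsum (fun n => ?_) hS fun n t ht => ?_) hmem
  · exact ((continuous_hypCoeff ha hb hc hpos n).mul continuous_const).continuousOn
  · exact hyp_bound hM hm ht.1.le ht.2.1.le ht.2.2.le le_rfl n

theorem hyp_zero (a b c : ℝ) : hyp a b c 0 = 1 := by
  rw [hyp, tsum_eq_single 0]
  · simp [hypCoeff]
  · intro n hn; rw [zero_pow hn, mul_zero]

theorem hyp_zero_left (b c x : ℝ) : hyp 0 b c x = 1 := by
  rw [hyp, tsum_eq_single 0]
  · simp [hypCoeff]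
  · intro n hn
    have : ∀ n, hypCoeff 0 b c (n + 1) = 0 := by
      intro n
      induction n with
      | zero => simp [hypCoeff]
      | succ n ih => rw [hypCoeff, ih, zero_mul]
    obtain ⟨k, rfl⟩ := Nat.exists_eq_succ_of_ne_zero hn
    rw [this, zero_mul]

theorem hyp_pos {a b c x : ℝ} (ha : 0 < a) (hb : 0 < b) (hc : 0 < c) (hx0 : 0 ≤ x) (hx : x < 1) :
    0 < hyp a b c x := by
  refine (summable_hypCoeff_mul_pow ha hb hc hx0 hx).tsum_pos
    (fun n => mul_nonneg (hypCoeff_pos ha hb hc n).le (pow_nonneg hx0 n)) 0 ?_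
  simp [hypCoeff]

theorem hasSum_deriv_coeff {a b c x : ℝ} (hc : 0 < c) (hx : |x| < 1) :
    HasSum (fun n : ℕ => ((n + 1 : ℕ) : ℝ) * hypCoeff a b c (n + 1) * x ^ n)
      (a * b / c * hyp (a + 1) (b + 1) (c + 1) x) := by
  have h := ((summable_hyp (a := a + 1) (b := b + 1) (by linarith : 0 < c + 1) hx).hasSum).mul_left
    (a * b / c)
  refine h.congr_fun fun n => ?_
  push_cast
  rw [hypCoeff_shift hc]
  ring

theorem hasDerivAt_hyp {a b c x : ℝ} (hc : 0 < c) (hx : |x| < 1) :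
    HasDerivAt (hyp a b c) (a * b / c * hyp (a + 1) (b + 1) (c + 1) x) x := by
  obtain ⟨r, hxr, hr⟩ := exists_between hx
  have hr0 : 0 ≤ r := (abs_nonneg x).trans hxr.le
  set M := |a * b / c| + |a + 1| + |b + 1| + 1
  have hM : 0 < M := by positivity
  have hS := (summable_hypCoeff_mul_pow hM hM (by linarith : 0 < c + 1) hr0 hr).mul_left
    |a * b / c|
  have hd : ∀ n : ℕ, ∀ y ∈ Metric.ball (0 : ℝ) r,
      HasDerivAt (fun y => hypCoeff a b c n * y ^ n) (hypCoeff a b c n * (n * y ^ (n - 1))) y :=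
    fun n y _ => (hasDerivAt_pow n y).const_mul _
  have hS' : Summable fun n : ℕ => if n = 0 then 0 else
      |a * b / c| * (hypCoeff M M (c + 1) (n - 1) * r ^ (n - 1)) := by
    rw [← summable_nat_add_iff 1]
    simpa using hS
  have h := hasDerivAt_tsum_of_isPreconnected hS' Metric.isOpen_ball
    (convex_ball (0 : ℝ) r).isPreconnected hd ?_
    (by simpa using (by linarith [abs_nonneg x] : 0 < r) : (0 : ℝ) ∈ Metric.ball 0 r)
    (summable_hyp hc (by simp)) (by simpa using hxr : x ∈ Metric.ball (0 : ℝ) r)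
  · have h1 := hasSum_deriv_coeff (a := a) (b := b) hc hx
    have h2 : HasSum (fun n : ℕ => hypCoeff a b c n * (n * x ^ (n - 1)))
      (a * b / c * hyp (a + 1) (b + 1) (c + 1) x) := by
      rw [← hasSum_nat_add_iff' 1]
      simp only [Finset.range_one, Finset.sum_singleton, Nat.cast_zero, zero_mul, mul_zero, sub_zero,
        Nat.add_sub_cancel]
      exact h1.congr_fun fun n => by ring
    rwa [h2.tsum_eq] at h
  · intro n y hy
    rcases n with _ | n
    · simp
    · have hy : |y| < r := by simpa using hy
      simp only [Nat.add_sub_cancel, Nat.succ_ne_zero, if_false]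
      have e : hypCoeff a b c (n + 1) * (((n + 1 : ℕ) : ℝ) * y ^ n)
          = a * b / c * (hypCoeff (a + 1) (b + 1) (c + 1) n * y ^ n) := by
        push_cast
        rw [← mul_assoc (a * b / c), ← hypCoeff_shift hc]; ring
      rw [e, norm_mul, Real.norm_eq_abs]
      refine mul_le_mul_of_nonneg_left (hyp_bound hM (by linarith) ?_ ?_ le_rfl hy.le n)
        (abs_nonneg _)
      · simp only [M]; linarith [abs_nonneg (a * b / c), abs_nonneg (b + 1)]
      · simp only [M]; linarith [abs_nonneg (a * b / c), abs_nonneg (a + 1)]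

theorem continuousOn_hyp {a b c : ℝ} (hc : 0 < c) : ContinuousOn (hyp a b c) (Ico 0 1) :=
  fun x hx => (hasDerivAt_hyp hc (by rw [abs_of_nonneg hx.1]; exact hx.2)).continuousAt
    |>.continuousWithinAt

/-- Gauss's differential equation. -/
theorem hyp_ode {a b c x : ℝ} (hc : 0 < c) (hx : |x| < 1) :
    x * (1 - x) * (a * b / c * ((a + 1) * (b + 1) / (c + 1) *
        hyp (a + 1 + 1) (b + 1 + 1) (c + 1 + 1) x))
      + (c - (a + b + 1) * x) * (a * b / c * hyp (a + 1) (b + 1) (c + 1) x)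
      - a * b * hyp a b c x = 0 := by
  set F0 := hyp a b c x
  set F1 := a * b / c * hyp (a + 1) (b + 1) (c + 1) x with hF1
  set F2 := a * b / c * ((a + 1) * (b + 1) / (c + 1) * hyp (a + 1 + 1) (b + 1 + 1) (c + 1 + 1) x)
    with hF2
  have s0 : HasSum (fun n : ℕ => hypCoeff a b c n * x ^ n) F0 := (summable_hyp hc hx).hasSum
  have s1 : HasSum (fun n : ℕ => ((n + 1 : ℕ) : ℝ) * hypCoeff a b c (n + 1) * x ^ n) F1 :=
    hasSum_deriv_coeff hc hx
  have s2 : HasSum (fun n : ℕ =>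
      ((n + 2 : ℕ) : ℝ) * ((n + 1 : ℕ) : ℝ) * hypCoeff a b c (n + 2) * x ^ n) F2 := by
    have h := (hasSum_deriv_coeff (a := a + 1) (b := b + 1) (by linarith : 0 < c + 1) hx).mul_left
      (a * b / c)
    refine h.congr_fun fun n => ?_
    have := hypCoeff_shift (a := a) (b := b) hc (n + 1)
    push_cast at this ⊢
    have h2 : hypCoeff a b c (n + 1 + 1) = hypCoeff a b c (n + 2) := rfl
    rw [h2] at this
    linear_combination (((n : ℝ) + 1) * x ^ n) * this
  -- The series of `x F'`, `x F''` and `x² F''` are re-indexed so that every general term carries `x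
  -- ^ n`; the index `0` terms vanish. The equation then reduces to the recursion of `hypCoeff`,
  -- coefficient by coefficient.
  have t1 : HasSum (fun n : ℕ => (n : ℝ) * hypCoeff a b c n * x ^ n) (x * F1) := by
    rw [← hasSum_nat_add_iff' 1]
    simp only [Finset.range_one, Finset.sum_singleton, Nat.cast_zero, zero_mul, sub_zero]
    exact (s1.mul_left x).congr_fun fun n => by ring
  have t2 : HasSum (fun n : ℕ =>
      ((n + 1 : ℕ) : ℝ) * n * hypCoeff a b c (n + 1) * x ^ n) (x * F2) := by
    rw [← hasSum_nat_add_iff' 1]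
    simp only [Finset.range_one, Finset.sum_singleton, Nat.cast_zero, mul_zero, zero_mul, sub_zero]
    exact (s2.mul_left x).congr_fun fun n => by ring
  have t3 : HasSum (fun n : ℕ =>
      (n : ℝ) * (n - 1) * hypCoeff a b c n * x ^ n) (x * (x * F2)) := by
    rw [← hasSum_nat_add_iff' 1]
    simp only [Finset.range_one, Finset.sum_singleton, Nat.cast_zero, zero_mul, sub_zero]
    exact (t2.mul_left x).congr_fun fun n => by push_cast; ring
  have h := ((t2.sub t3).add ((s1.mul_left c).sub (t1.mul_left (a + b + 1)))).sub
    (s0.mul_left (a * b))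
  have hz : ∀ n : ℕ, ((n + 1 : ℕ) : ℝ) * n * hypCoeff a b c (n + 1) * x ^ n
      - (n : ℝ) * (n - 1) * hypCoeff a b c n * x ^ n
      + (c * (((n + 1 : ℕ) : ℝ) * hypCoeff a b c (n + 1) * x ^ n)
        - (a + b + 1) * ((n : ℝ) * hypCoeff a b c n * x ^ n))
      - a * b * (hypCoeff a b c n * x ^ n) = 0 := by
    intro n
    have h1 : c + n ≠ 0 := by positivity
    have h2 : (n : ℝ) + 1 ≠ 0 := by positivity
    rw [hypCoeff]
    push_cast
    field_simp
    ring
  simp only [hz] at h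
  linear_combination h.unique hasSum_zero

/-- For `-1 < a < 0` the hypergeometric function is strictly decreasing. -/
theorem hyp_strictAntiOn {a b c : ℝ} (ha : -1 < a) (ha0 : a < 0) (hb : 0 < b) (hc : 0 < c) :
    StrictAntiOn (hyp a b c) (Ico 0 1) := by
  refine strictAntiOn_of_deriv_neg (convex_Ico 0 1) (continuousOn_hyp hc) fun x hx => ?_
  rw [interior_Ico] at hx
  rw [(hasDerivAt_hyp hc (by rw [abs_of_pos hx.1]; exact hx.2)).deriv]
  have := hyp_pos (by linarith : 0 < a + 1) (by linarith : 0 < b + 1) (by linarith : 0 < c + 1)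
    hx.1.le hx.2
  exact mul_neg_of_neg_of_pos (div_neg_of_neg_of_pos (mul_neg_of_neg_of_pos ha0 hb) hc) this

/-! ### Decaying solutions of the Pöschl–Teller equation `U'' = (κ² - s (s + 1) sech² y) U` -/

theorem hasDerivAt_tanh (y : ℝ) : HasDerivAt Real.tanh (1 - Real.tanh y ^ 2) y := by
  have h := (Real.hasDerivAt_sinh y).div (Real.hasDerivAt_cosh y) (Real.cosh_pos y).ne'
  have e : Real.tanh = Real.sinh / Real.cosh := funext fun x => Real.tanh_eq_sinh_div_cosh x
  have hc := (Real.cosh_pos y).ne'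
  rw [e]
  refine h.congr_deriv ?_
  rw [Pi.div_apply]
  field_simp

theorem one_div_cosh_sq (y : ℝ) : (1 / Real.cosh y) ^ 2 = 1 - Real.tanh y ^ 2 := by
  have hc := (Real.cosh_pos y).ne'
  rw [Real.tanh_eq_sinh_div_cosh]
  field_simp
  linarith [Real.cosh_sq y]

/-- The change of variables `y ↦ (1 - tanh y) / 2`. -/
def tanhVar (y : ℝ) : ℝ := (1 - Real.tanh y) / 2

theorem tanhVar_pos (y : ℝ) : 0 < tanhVar y := by
  have := Real.tanh_lt_one y
  unfold tanhVar; linarith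

theorem tanhVar_lt_one (y : ℝ) : tanhVar y < 1 := by
  have := (abs_lt.1 (Real.abs_tanh_lt_one y)).1
  unfold tanhVar; linarith

theorem tanhVar_mem (y : ℝ) : tanhVar y ∈ Ico (0 : ℝ) 1 := ⟨(tanhVar_pos y).le, tanhVar_lt_one y⟩

theorem abs_tanhVar_lt (y : ℝ) : |tanhVar y| < 1 := by
  rw [abs_of_pos (tanhVar_pos y)]; exact tanhVar_lt_one y

theorem hasDerivAt_tanhVar (y : ℝ) : HasDerivAt tanhVar (-(1 - Real.tanh y ^ 2) / 2) y := by
  refine (((hasDerivAt_tanh y).const_sub 1).div_const 2).congr_deriv ?_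
  ring

theorem strictMono_tanh : StrictMono Real.tanh := by
  refine strictMono_of_deriv_pos fun y => ?_
  rw [(hasDerivAt_tanh y).deriv]
  linarith [Real.tanh_sq_lt_one y]

theorem strictAnti_tanhVar : StrictAnti tanhVar := fun x y h => by
  have := strictMono_tanh h
  unfold tanhVar; linarith

theorem tanhVar_zero : tanhVar 0 = 1 / 2 := by simp [tanhVar]

/-- `sech^κ y`. -/
def sechPow (κ y : ℝ) : ℝ := Real.exp (-κ * Real.log (Real.cosh y))

theorem sechPow_pos (κ y : ℝ) : 0 < sechPow κ y := Real.exp_pos _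

theorem hasDerivAt_sechPow (κ y : ℝ) :
    HasDerivAt (sechPow κ) (sechPow κ y * (-κ * Real.tanh y)) y := by
  have h := (((Real.hasDerivAt_cosh y).log (Real.cosh_pos y).ne').const_mul (-κ)).exp
  rw [← Real.tanh_eq_sinh_div_cosh] at h
  exact h

theorem sechPow_le {κ : ℝ} (hκ : 0 ≤ κ) (y : ℝ) :
    sechPow κ y ≤ Real.exp (κ * Real.log 2) * Real.exp (-κ * y) := by
  rw [← Real.exp_add, sechPow, Real.exp_le_exp]
  have h1 : y - Real.log 2 ≤ Real.log (Real.cosh y) := by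
    have : Real.exp y / 2 ≤ Real.cosh y := by
      rw [Real.cosh_eq]
      linarith [Real.exp_pos (-y)]
    have h2 := Real.log_le_log (by positivity) this
    rwa [Real.log_div (Real.exp_pos y).ne' two_ne_zero, Real.log_exp] at h2
  nlinarith

/-- The hypergeometric factor of the decaying solution. -/
def jostFactor (s κ x : ℝ) : ℝ := hyp (κ - s) (κ + s + 1) (1 + κ) x

/-- The derivative of `jostFactor`. -/
def jostFactorDeriv (s κ x : ℝ) : ℝ :=
  (κ - s) * (κ + s + 1) / (1 + κ) * hyp (κ - s + 1) (κ + s + 1 + 1) (1 + κ + 1) x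

/-- The solution of `U'' = (κ² - s (s + 1) sech² y) U` that decays at `+∞`. -/
def jost (s κ y : ℝ) : ℝ := sechPow κ y * jostFactor s κ (tanhVar y)

/-- The derivative of `jost`. -/
def jostDeriv (s κ y : ℝ) : ℝ :=
  sechPow κ y * (-κ * Real.tanh y * jostFactor s κ (tanhVar y)
    - (1 - Real.tanh y ^ 2) / 2 * jostFactorDeriv s κ (tanhVar y))

theorem hasDerivAt_jostFactor {s κ x : ℝ} (hκ : 0 < κ) (hx : |x| < 1) :
    HasDerivAt (jostFactor s κ) (jostFactorDeriv s κ x) x :=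
  hasDerivAt_hyp (by linarith) hx

theorem hasDerivAt_jost {s κ : ℝ} (hκ : 0 < κ) (y : ℝ) :
    HasDerivAt (jost s κ) (jostDeriv s κ y) y := by
  refine ((hasDerivAt_sechPow κ y).mul ((hasDerivAt_jostFactor hκ (abs_tanhVar_lt y)).comp y
    (hasDerivAt_tanhVar y))).congr_deriv ?_
  rw [jostDeriv]
  simp only [Function.comp_apply]
  ring

/-- This is Gauss's equation after the substitution `ξ = (1 - tanh y) / 2`, for which `ξ (1 - ξ) =
(1 - tanh² y) / 4`; hence the factor `sech^κ y (1 - tanh² y)` in front of it in the final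
combination. -/
theorem hasDerivAt_jostDeriv {s κ : ℝ} (hκ : 0 < κ) (y : ℝ) :
    HasDerivAt (jostDeriv s κ)
      ((κ ^ 2 - s * (s + 1) * (1 - Real.tanh y ^ 2)) * jost s κ y) y := by
  have hx := abs_tanhVar_lt y
  have hF := (hasDerivAt_jostFactor (s := s) hκ hx).comp y (hasDerivAt_tanhVar y)
  have hF' : HasDerivAt (jostFactorDeriv s κ) _ (tanhVar y) :=
    (hasDerivAt_hyp (a := κ - s + 1) (b := κ + s + 1 + 1) (by linarith : 0 < 1 + κ + 1) hx).const_mul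
    ((κ - s) * (κ + s + 1) / (1 + κ))
  have hF'' := hF'.comp y (hasDerivAt_tanhVar y)
  have hT := hasDerivAt_tanh y
  have h := (hasDerivAt_sechPow κ y).mul (((hT.const_mul (-κ)).mul hF).sub
    ((((hT.pow 2).const_sub 1).div_const 2).mul hF''))
  refine h.congr_deriv ?_
  have ode := hyp_ode (a := κ - s) (b := κ + s + 1) (by linarith : 0 < 1 + κ) hx
  simp only [Function.comp_apply, Pi.mul_apply, Pi.pow_apply, Pi.sub_apply]
  rw [jost, jostFactorDeriv, jostFactor]
  have hξ : tanhVar y = (1 - Real.tanh y) / 2 := rfl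
  generalize hyp (κ - s + 1 + 1) (κ + s + 1 + 1 + 1) (1 + κ + 1 + 1) (tanhVar y) = F2 at *
  generalize hyp (κ - s + 1) (κ + s + 1 + 1) (1 + κ + 1) (tanhVar y) = F1 at *
  generalize hyp (κ - s) (κ + s + 1) (1 + κ) (tanhVar y) = F0 at *
  rw [hξ] at ode
  linear_combination (sechPow κ y * (1 - Real.tanh y ^ 2)) * ode

/-- For `y ≥ c` the variable `ξ` stays in a compact part of `[0, 1)`, where the hypergeometric
factors are bounded. The constant has to depend on `c`, since no bound is available as `ξ → 1`, that
is `y → -∞`. -/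
theorem jost_exp_bound (s : ℝ) {κ : ℝ} (hκ : 0 < κ) (c : ℝ) :
    ∃ C, ∀ y, c ≤ y → |jost s κ y| ≤ C * Real.exp (-κ * y) ∧
      |jostDeriv s κ y| ≤ C * Real.exp (-κ * y) := by
  have hsub : Icc 0 (tanhVar c) ⊆ Ico (0 : ℝ) 1 := fun x hx =>
    ⟨hx.1, hx.2.trans_lt (tanhVar_lt_one c)⟩
  obtain ⟨C0, hC0⟩ := isCompact_Icc.exists_bound_of_continuousOn
    ((continuousOn_hyp (a := κ - s) (b := κ + s + 1) (by linarith : 0 < 1 + κ)).mono hsub)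
  obtain ⟨C1, hC1⟩ := isCompact_Icc.exists_bound_of_continuousOn
    (((continuousOn_hyp (a := κ - s + 1) (b := κ + s + 1 + 1)
      (by linarith : 0 < 1 + κ + 1)).mono hsub).const_mul
      ((κ - s) * (κ + s + 1) / (1 + κ)))
  have hmem : ∀ y, c ≤ y → tanhVar y ∈ Icc 0 (tanhVar c) := fun y hy =>
    ⟨(tanhVar_pos y).le, strictAnti_tanhVar.antitone hy⟩
  have key : ∀ y t B : ℝ, 0 ≤ B → |t| ≤ B →
      |sechPow κ y * t| ≤ Real.exp (κ * Real.log 2) * B * Real.exp (-κ * y) := by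
    intro y t B hB ht
    rw [abs_mul, abs_of_pos (sechPow_pos κ y)]
    calc sechPow κ y * |t| ≤ (Real.exp (κ * Real.log 2) * Real.exp (-κ * y)) * B := by
          gcongr
          exact sechPow_le hκ.le y
      _ = _ := by ring
  have hC0' : 0 ≤ C0 := (norm_nonneg _).trans (hC0 _ (hmem c le_rfl))
  have hC1' : 0 ≤ C1 := (norm_nonneg _).trans (hC1 _ (hmem c le_rfl))
  refine ⟨Real.exp (κ * Real.log 2) * (C0 + (κ * C0 + C1)), fun y hy => ⟨?_, ?_⟩⟩
  · refine key y _ _ (by positivity) ?_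
    have := hC0 _ (hmem y hy)
    rw [Real.norm_eq_abs] at this
    have h2 : 0 ≤ κ * C0 + C1 := by positivity
    exact this.trans (by linarith)
  · refine key y _ _ (by positivity) ?_
    have h0 := hC0 _ (hmem y hy)
    have h1 := hC1 _ (hmem y hy)
    rw [Real.norm_eq_abs] at h0 h1
    have hT := (Real.abs_tanh_lt_one y).le
    have hT2 := Real.tanh_sq_lt_one y
    refine (abs_sub _ _).trans ?_
    have e1 : |-κ * Real.tanh y * jostFactor s κ (tanhVar y)| ≤ κ * 1 * C0 := by
      rw [abs_mul, abs_mul, abs_neg, abs_of_pos hκ]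
      gcongr
      exact h0
    have e2 : |(1 - Real.tanh y ^ 2) / 2 * jostFactorDeriv s κ (tanhVar y)| ≤ 1 * C1 := by
      rw [abs_mul, abs_of_nonneg (by linarith : 0 ≤ (1 - Real.tanh y ^ 2) / 2)]
      gcongr
      · linarith [sq_nonneg (Real.tanh y)]
      · exact h1
    linarith

theorem tendsto_zero_of_exp_bound {f : ℝ → ℝ} {C κ c : ℝ} (hκ : 0 < κ)
    (h : ∀ y, c ≤ y → |f y| ≤ C * Real.exp (-κ * y)) :
    Filter.Tendsto f Filter.atTop (nhds 0) := by
  refine squeeze_zero_norm' (a := fun y => C * Real.exp (-κ * y)) ?_ ?_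
  · filter_upwards [Filter.eventually_ge_atTop c] with y hy using h y hy
  · have : Filter.Tendsto (fun y : ℝ => κ * y) Filter.atTop Filter.atTop :=
      Filter.tendsto_id.const_mul_atTop hκ
    have h2 := (Real.tendsto_exp_neg_atTop_nhds_zero.comp this).const_mul C
    rw [mul_zero] at h2
    refine h2.congr fun y => ?_
    simp [Function.comp]

theorem tendsto_jost (s : ℝ) {κ : ℝ} (hκ : 0 < κ) :
    Filter.Tendsto (jost s κ) Filter.atTop (nhds 0) := by
  obtain ⟨C, hC⟩ := jost_exp_bound s hκ 0
  exact tendsto_zero_of_exp_bound hκ fun y hy => (hC y hy).1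

theorem tendsto_jostDeriv (s : ℝ) {κ : ℝ} (hκ : 0 < κ) :
    Filter.Tendsto (jostDeriv s κ) Filter.atTop (nhds 0) := by
  obtain ⟨C, hC⟩ := jost_exp_bound s hκ 0
  exact tendsto_zero_of_exp_bound hκ fun y hy => (hC y hy).2

/-- `jost` does not vanish near `+∞`. -/
theorem eventually_jost_pos (s : ℝ) {κ : ℝ} (hκ : 0 < κ) :
    ∀ᶠ y in Filter.atTop, 0 < jost s κ y := by
  have hcont : ContinuousAt (jostFactor s κ) 0 :=
    (hasDerivAt_jostFactor (s := s) hκ (by simp)).continuousAt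
  have hT : Filter.Tendsto tanhVar Filter.atTop (nhds 0) := by
    have h1 : ∀ y, tanhVar y = sechPow 1 y * Real.exp (-y) / 2 := by
      intro y
      have hc := Real.cosh_pos y
      rw [tanhVar, sechPow, neg_one_mul, Real.exp_neg (Real.log _), Real.exp_log hc,
        Real.tanh_eq_sinh_div_cosh, ← Real.cosh_sub_sinh]
      field_simp
    have h2 : ∀ y, (0 : ℝ) ≤ y → |tanhVar y| ≤ 1 * Real.exp (-1 * y) := by
      intro y hy
      rw [abs_of_pos (tanhVar_pos y), h1]
      have : sechPow 1 y ≤ 1 := by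
        rw [sechPow, Real.exp_le_one_iff]
        have := Real.log_nonneg (Real.one_le_cosh y)
        linarith
      rw [neg_one_mul]
      nlinarith [Real.exp_pos (-y)]
    exact tendsto_zero_of_exp_bound one_pos h2
  have h := (hcont.tendsto.comp hT)
  rw [jostFactor, hyp_zero] at h
  filter_upwards [h.eventually (lt_mem_nhds zero_lt_one)] with y hy
  exact mul_pos (sechPow_pos κ y) hy

/-- The potential is even, so `y ↦ U(-y)` solves the same equation and its Wronskian with `U` is
constant; it is evaluated at `0`. This is what makes the matching condition at the vertex
independent of the shift. -/
theorem jost_wronskian_const (s : ℝ) {κ : ℝ} (hκ : 0 < κ) (b : ℝ) :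
    jost s κ b * jostDeriv s κ (-b) + jostDeriv s κ b * jost s κ (-b)
      = 2 * (jost s κ 0 * jostDeriv s κ 0) := by
  have hd : ∀ y, HasDerivAt (fun y => jost s κ y * jostDeriv s κ (-y)
      + jostDeriv s κ y * jost s κ (-y)) 0 y := by
    intro y
    have h1 := (hasDerivAt_jost (s := s) hκ (-y)).comp y (hasDerivAt_neg y)
    have h2 := (hasDerivAt_jostDeriv (s := s) hκ (-y)).comp y (hasDerivAt_neg y)
    refine (((hasDerivAt_jost (s := s) hκ y).mul h2).add
      ((hasDerivAt_jostDeriv (s := s) hκ y).mul h1)).congr_deriv ?_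
    simp only [Function.comp_apply, Real.tanh_neg]
    ring
  have := is_const_of_deriv_eq_zero (fun y => (hd y).differentiableAt) (fun y => (hd y).deriv) b 0
  simp only [neg_zero] at this
  rw [this]; ring

/-- Comparison of two positive decaying solutions with different decay rates. -/
theorem jost_wronskian_neg {s κ κ' c : ℝ} (hκ' : 0 < κ') (h : κ' < κ)
    (hU : ∀ y, c < y → 0 < jost s κ y) (hU' : ∀ y, c < y → 0 < jost s κ' y) :
    jostDeriv s κ c * jost s κ' c - jost s κ c * jostDeriv s κ' c < 0 := by
  have hκ : 0 < κ := hκ'.trans h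
  set w : ℝ → ℝ := fun y => jostDeriv s κ y * jost s κ' y - jost s κ y * jostDeriv s κ' y with hw
  have hd : ∀ y, HasDerivAt w ((κ ^ 2 - κ' ^ 2) * (jost s κ y * jost s κ' y)) y := by
    intro y
    refine (((hasDerivAt_jostDeriv (s := s) hκ y).mul (hasDerivAt_jost (s := s) hκ' y)).sub
      ((hasDerivAt_jost (s := s) hκ y).mul (hasDerivAt_jostDeriv (s := s) hκ' y))).congr_deriv ?_
    ring
  have hmono : StrictMonoOn w (Ici c) := by
    refine strictMonoOn_of_deriv_pos (convex_Ici c)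
      (fun y _ => (hd y).continuousAt.continuousWithinAt) fun y hy => ?_
    rw [interior_Ici] at hy
    rw [(hd y).deriv]
    exact mul_pos (by nlinarith) (mul_pos (hU y hy) (hU' y hy))
  have hlim : Filter.Tendsto w Filter.atTop (nhds 0) := by
    have := ((tendsto_jostDeriv s hκ).mul (tendsto_jost s hκ')).sub
      ((tendsto_jost s hκ).mul (tendsto_jostDeriv s hκ'))
    simpa using this
  -- A function that increases strictly to the limit `0` is negative. The intermediate point `c + 1`
  -- keeps the inequality strict through the limit.
  have h1 : w c < w (c + 1) := hmono self_mem_Ici (by simp) (by simp)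
  have h2 : w (c + 1) ≤ 0 := by
    refine ge_of_tendsto hlim ?_
    filter_upwards [Filter.eventually_ge_atTop (c + 1)] with y hy
    exact hmono.monotoneOn (by simp) (show c ≤ y by linarith) hy
  exact h1.trans_le h2

/-! ### Zeros of the decaying solution as the decay rate varies -/

theorem continuous_jostFactor_param (s : ℝ) {x : ℝ} (hx : |x| < 1) :
    ContinuousOn (fun κ => jostFactor s κ x) (Ioi 0) := by
  rw [continuousOn_iff_continuous_domRestrict]
  refine continuous_hyp_param (X := Ioi (0 : ℝ)) (a := fun t => t.1 - s)
    (b := fun t => t.1 + s + 1) (c := fun t => 1 + t.1) (by fun_prop) (by fun_prop) (by fun_prop)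
    (fun t => ?_) hx
  have : (0 : ℝ) < t.1 := t.2
  linarith

theorem continuous_jostFactorDeriv_param (s : ℝ) {x : ℝ} (hx : |x| < 1) :
    ContinuousOn (fun κ => hyp (κ - s + 1) (κ + s + 1 + 1) (1 + κ + 1) x) (Ioi 0) := by
  rw [continuousOn_iff_continuous_domRestrict]
  refine continuous_hyp_param (X := Ioi (0 : ℝ)) (a := fun t => t.1 - s + 1)
    (b := fun t => t.1 + s + 1 + 1) (c := fun t => 1 + t.1 + 1) (by fun_prop) (by fun_prop)
    (by fun_prop) (fun t => ?_) hx
  have : (0 : ℝ) < t.1 := t.2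
  linarith

theorem exists_interval_of_continuousOn {f : ℝ → ℝ} (hf : ContinuousOn f (Ioi 0)) {c : ℝ}
    (hc : 0 < c) (h : f c ≠ 0) : ∃ η, 0 < η ∧ ∀ t, |t - c| < η → f t ≠ 0 := by
  have h1 : ∀ᶠ t in nhds c, f t ≠ 0 :=
    (hf.continuousAt (Ioi_mem_nhds hc)).eventually_ne h
  obtain ⟨η, h2, h3⟩ := Metric.eventually_nhds_iff.1 h1
  exact ⟨η, h2, fun t ht => h3 (by rwa [Real.dist_eq])⟩

theorem jost_pos_iff {s κ y : ℝ} : 0 < jost s κ y ↔ 0 < jostFactor s κ (tanhVar y) :=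
  mul_pos_iff_of_pos_left (sechPow_pos κ y)

theorem jost_ne_zero_iff {s κ y : ℝ} : jost s κ y ≠ 0 ↔ jostFactor s κ (tanhVar y) ≠ 0 := by
  rw [jost, mul_ne_zero_iff]
  exact ⟨fun h => h.2, fun h => ⟨(sechPow_pos κ y).ne', h⟩⟩

/-- For `κ > s` all hypergeometric parameters are positive; for `κ = s` the series is the constant
`1` and the solution is `sech^s`. -/
theorem jost_pos {s κ : ℝ} (hs : 0 < s) (h : s ≤ κ) (y : ℝ) : 0 < jost s κ y := by
  rw [jost_pos_iff, jostFactor]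
  rcases h.eq_or_lt with rfl | h
  · rw [sub_self, hyp_zero_left]; exact one_pos
  · exact hyp_pos (by linarith) (by linarith) (by linarith) (tanhVar_pos y).le (tanhVar_lt_one y)

theorem jostDeriv_zero_right (s κ : ℝ) :
    jostDeriv s κ 0 = - sechPow κ 0 / 2 * jostFactorDeriv s κ (1 / 2) := by
  rw [jostDeriv, tanhVar_zero, Real.tanh_zero]; ring

/-- The derivative at `0` carries the explicit factor `κ - s`, so apart from the ground state only
the shifted hypergeometric function at `ξ = 1/2` can make it vanish. -/
theorem jostDeriv_zero_ne_zero {s κ : ℝ} (hκ : 0 < κ) (hs : 0 < s) (h : κ ≠ s)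
    (h' : hyp (κ - s + 1) (κ + s + 1 + 1) (1 + κ + 1) (1 / 2) ≠ 0) : jostDeriv s κ 0 ≠ 0 := by
  rw [jostDeriv_zero_right, jostFactorDeriv]
  have := (sechPow_pos κ 0).ne'
  have h1 : κ - s ≠ 0 := sub_ne_zero.2 h
  have h2 : κ + s + 1 ≠ 0 := by positivity
  have h3 : 1 + κ ≠ 0 := by positivity
  exact mul_ne_zero (div_ne_zero (neg_ne_zero.2 this) two_ne_zero)
    (mul_ne_zero (div_ne_zero (mul_ne_zero h1 h2) h3) h')

theorem jostDeriv_self_zero (s : ℝ) : jostDeriv s s 0 = 0 := by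
  rw [jostDeriv_zero_right, jostFactorDeriv]; simp

theorem jostFactorDeriv_neg {s κ x : ℝ} (hκ : 0 < κ) (h1 : s - 1 < κ) (h2 : κ < s)
    (hx0 : 0 ≤ x) (hx : x < 1) : jostFactorDeriv s κ x < 0 := by
  have := hyp_pos (by linarith : 0 < κ - s + 1) (by linarith : 0 < κ + s + 1 + 1)
    (by linarith : 0 < 1 + κ + 1) hx0 hx
  exact mul_neg_of_neg_of_pos (div_neg_of_neg_of_pos (mul_neg_of_neg_of_pos (by linarith)
    (by linarith)) (by linarith)) this

theorem jostFactor_strictAntiOn {s κ : ℝ} (hκ : 0 < κ) (h1 : s - 1 < κ) (h2 : κ < s) :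
    StrictAntiOn (jostFactor s κ) (Ico 0 1) :=
  hyp_strictAntiOn (by linarith) (by linarith) (by linarith) (by linarith)

/-- If `s - 1 < κ < s` and `jost` vanishes at `c`, it is positive to the right of `c`. -/
theorem jost_pos_of_zero {s κ c : ℝ} (hκ : 0 < κ) (h1 : s - 1 < κ) (h2 : κ < s)
    (h : jost s κ c = 0) (y : ℝ) (hy : c < y) : 0 < jost s κ y := by
  rw [jost_pos_iff]
  have h0 : jostFactor s κ (tanhVar c) = 0 := by
    by_contra h'
    exact jost_ne_zero_iff.2 h' h
  rw [← h0]
  exact jostFactor_strictAntiOn hκ h1 h2 (tanhVar_mem y) (tanhVar_mem c) (strictAnti_tanhVar hy)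

/-- The first excited state. -/
theorem jost_sub_one {s : ℝ} (hs : 1 < s) (y : ℝ) :
    jost s (s - 1) y = sechPow (s - 1) y * Real.tanh y := by
  -- At `κ = s - 1` the first parameter is `-1`, so the series stops at `1 - 2 ξ = tanh y`.
  have h2 : ∀ n, hypCoeff (s - 1 - s) (s - 1 + s + 1) (1 + (s - 1)) (n + 2) = 0 := by
    intro n
    induction n with
    | zero => simp [hypCoeff]
    | succ n ih => rw [show n + 1 + 2 = n + 2 + 1 from rfl, hypCoeff, ih, zero_mul]
  rw [jost, jostFactor, hyp, tsum_eq_sum (s := Finset.range 2)]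
  · have : s ≠ 0 := by positivity
    simp only [Finset.sum_range_succ, Finset.range_zero, Finset.sum_empty, hypCoeff, tanhVar]
    congr 1
    push_cast
    have e : (1 : ℝ) + (s - 1) + 0 = s := by ring
    rw [e]
    field_simp
    ring
  · intro n hn
    obtain ⟨k, rfl⟩ := Nat.exists_eq_add_of_le (not_lt.1 (Finset.mem_range.not.1 hn))
    rw [add_comm 2 k, h2, zero_mul]

theorem tanh_pos {y : ℝ} (hy : 0 < y) : 0 < Real.tanh y := by
  simpa using strictMono_tanh hy

/-- Sturm comparison with the explicit solution at rate `s - 1`, which is positive on `(0, ∞)`. For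
`s - 1 < κ < s`, a zero at `b ≥ 0` would be crossed upwards, since the hypergeometric factor
decreases in `ξ`; the Wronskian at `b` would then be non-negative, against `jost_wronskian_neg`. -/
theorem jost_ne_zero_of_nonneg {s κ b : ℝ} (hs : 1 < s) (h1 : s - 1 < κ) (hb : 0 ≤ b) :
    jost s κ b ≠ 0 := by
  have hκ : 0 < κ := by linarith
  rcases le_or_gt s κ with h2 | h2
  · exact (jost_pos (by linarith) h2 b).ne'
  intro h0
  have hF0 : jostFactor s κ (tanhVar b) = 0 := by
    by_contra h'
    exact jost_ne_zero_iff.2 h' h0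
  have hw := jost_wronskian_neg (c := b) (by linarith : 0 < s - 1) h1
    (jost_pos_of_zero hκ h1 h2 h0) fun y hy => by
      rw [jost_sub_one hs]
      exact mul_pos (sechPow_pos _ _) (tanh_pos (hb.trans_lt hy))
  rw [h0, zero_mul, sub_zero, jost_sub_one hs, jostDeriv, hF0, mul_zero, zero_sub] at hw
  have hD := jostFactorDeriv_neg hκ h1 h2 (tanhVar_pos b).le (tanhVar_lt_one b)
  have hT := Real.tanh_sq_lt_one b
  have hT0 : 0 ≤ Real.tanh b := by
    rcases hb.eq_or_lt with rfl | hb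
    · simp
    · exact (tanh_pos hb).le
  have : 0 ≤ sechPow κ b * -((1 - Real.tanh b ^ 2) / 2 * jostFactorDeriv s κ (tanhVar b))
      * (sechPow (s - 1) b * Real.tanh b) := by
    refine mul_nonneg (mul_nonneg (sechPow_pos _ _).le ?_) (mul_nonneg (sechPow_pos _ _).le hT0)
    nlinarith
  linarith

/-- The zeros of the boundary data of `jost` near and above `κ = s`. -/
theorem exists_gap_ground {s : ℝ} (hs : 0 < s) (b : ℝ) :
    ∃ η, 0 < η ∧ η < s ∧ ∀ κ, s - η < κ → κ ≠ s →
      jost s κ b ≠ 0 ∧ jost s κ (-b) ≠ 0 ∧ jost s κ 0 ≠ 0 ∧ jostDeriv s κ 0 ≠ 0 := by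
  -- At `κ = s` the hypergeometric factor is `1`, so continuity in `κ` keeps it non-zero nearby; for
  -- `κ ≥ s` it is positive anyway.
  have key : ∀ y, ∃ η, 0 < η ∧ ∀ κ, |κ - s| < η → jost s κ y ≠ 0 := by
    intro y
    obtain ⟨η, h0, h1⟩ := exists_interval_of_continuousOn
      (continuous_jostFactor_param s (abs_tanhVar_lt y)) hs
      (by rw [jostFactor, sub_self, hyp_zero_left]; exact one_ne_zero)
    exact ⟨η, h0, fun κ hκ => jost_ne_zero_iff.2 (h1 κ hκ)⟩
  have key' : ∀ y, ∃ η, 0 < η ∧ ∀ κ, s - η < κ → jost s κ y ≠ 0 := by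
    intro y
    obtain ⟨η, h0, h1⟩ := key y
    refine ⟨η, h0, fun κ hκ => ?_⟩
    rcases le_or_gt s κ with h | h
    · exact (jost_pos hs h y).ne'
    · exact h1 κ (by rw [abs_lt]; constructor <;> linarith)
  obtain ⟨η1, p1, h1⟩ := key' b
  obtain ⟨η2, p2, h2⟩ := key' (-b)
  obtain ⟨η3, p3, h3⟩ := key' 0
  -- The bound `s / 2` keeps `κ > 0`, and the bound `1` keeps `κ - s + 1 > 0`, so that the series
  -- controlling the derivative at `0` has positive parameters.
  refine ⟨min (min η1 η2) (min η3 (min (s / 2) 1)), by positivity, ?_, fun κ hκ hne => ?_⟩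
  · exact ((min_le_right _ _).trans ((min_le_right _ _).trans (min_le_left _ _))).trans_lt
      (by linarith)
  · have e1 := min_le_left (min η1 η2) (min η3 (min (s / 2) 1))
    have e2 := min_le_right (min η1 η2) (min η3 (min (s / 2) 1))
    have e3 := min_le_left η1 η2
    have e4 := min_le_right η1 η2
    have e5 := min_le_left η3 (min (s / 2) 1)
    have e6 := min_le_right η3 (min (s / 2) 1)
    have e7 := min_le_left (s / 2) 1
    have e8 := min_le_right (s / 2) 1
    refine ⟨h1 κ (by linarith), h2 κ (by linarith), h3 κ (by linarith),
      jostDeriv_zero_ne_zero (by linarith) hs hne (hyp_pos ?_ ?_ ?_ ?_ ?_).ne'⟩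
      <;> linarith

/-- The shifted series decreases on `[0, 1/2]` and is non-negative at the right end, so the factor
itself is strictly decreasing there. If it vanished at `ξ = 1/2`, the solution would be positive for
`y > 0`. The solution at rate `s - 1` is positive there as well and also vanishes at `0`, so the
Wronskian at `0` would be zero, against `jost_wronskian_neg`. -/
theorem jost_zero_ne_zero_of_lt {s κ : ℝ} (hs : 1 < s) (hκ : 0 < κ) (h1 : s - 2 < κ)
    (h2 : κ < s - 1) (h : 0 ≤ hyp (κ - s + 1) (κ + s + 1 + 1) (1 + κ + 1) (1 / 2)) :
    jost s κ 0 ≠ 0 := by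
  intro h0
  have hF0 : jostFactor s κ (1 / 2) = 0 := by
    by_contra h'
    exact jost_ne_zero_iff.2 (by rwa [tanhVar_zero]) h0
  have hanti := hyp_strictAntiOn (by linarith : -1 < κ - s + 1) (by linarith)
    (by linarith : 0 < κ + s + 1 + 1) (by linarith : 0 < 1 + κ + 1)
  have hF : StrictAntiOn (jostFactor s κ) (Icc 0 (1 / 2)) := by
    refine strictAntiOn_of_deriv_neg (convex_Icc _ _)
      ((continuousOn_hyp (by linarith)).mono fun x hx => ⟨hx.1, by linarith [hx.2]⟩) fun x hx => ?_
    rw [interior_Icc] at hx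
    rw [(hasDerivAt_jostFactor hκ (by rw [abs_of_pos hx.1]; linarith [hx.2])).deriv]
    have := hanti (show x ∈ Ico (0 : ℝ) 1 from ⟨hx.1.le, by linarith [hx.2]⟩)
      (show (1 / 2 : ℝ) ∈ Ico (0 : ℝ) 1 by norm_num) hx.2
    exact mul_neg_of_neg_of_pos (div_neg_of_neg_of_pos (mul_neg_of_neg_of_pos (by linarith)
      (by linarith)) (by linarith)) (by linarith)
  have hpos : ∀ y, 0 < y → 0 < jost s κ y := fun y hy => by
    rw [jost_pos_iff, ← hF0]
    have := strictAnti_tanhVar hy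
    rw [tanhVar_zero] at this
    exact hF ⟨(tanhVar_pos y).le, this.le⟩ ⟨by norm_num, le_rfl⟩ this
  have hw := jost_wronskian_neg (c := 0) hκ h2 (fun y hy => by
      rw [jost_sub_one hs]
      exact mul_pos (sechPow_pos _ _) (tanh_pos hy)) hpos
  rw [h0, jost_sub_one hs] at hw
  simp at hw

/-- The zeros of the boundary data of `jost` near and above `κ = s - 1`. -/
theorem exists_gap_excited {s b : ℝ} (hs : 1 < s) (hb : 0 < b) :
    ∃ κ₁ η, s - 1 < κ₁ ∧ κ₁ < s ∧ 0 < η ∧ η < s - 1 ∧ jost s κ₁ (-b) = 0 ∧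
      ∀ κ, s - 1 - η < κ → jost s κ b ≠ 0 ∧ (jost s κ (-b) = 0 → κ = κ₁) ∧
        (jost s κ 0 = 0 → κ = s - 1) ∧ (jostDeriv s κ 0 = 0 → κ = s) := by
  have hs0 : 0 < s - 1 := by linarith
  have hneg : jost s (s - 1) (-b) < 0 := by
    rw [jost_sub_one hs, Real.tanh_neg]
    exact mul_neg_of_pos_of_neg (sechPow_pos _ _) (neg_lt_zero.2 (tanh_pos hb))
  -- The value at `-b` is negative for `κ = s - 1`, where the solution has the sign of `tanh`, and
  -- positive for `κ = s`.
  obtain ⟨κ₁, ⟨hk1, hk2⟩, hk⟩ : ∃ κ ∈ Ioo (s - 1) s, jostFactor s κ (tanhVar (-b)) = 0 := by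
    have hc : ContinuousOn (fun κ => jostFactor s κ (tanhVar (-b))) (Icc (s - 1) s) :=
      (continuous_jostFactor_param s (abs_tanhVar_lt (-b))).mono fun x hx => hs0.trans_le hx.1
    refine intermediate_value_Ioo (by linarith) hc ⟨?_, ?_⟩
    · rw [jost] at hneg
      exact (pos_iff_neg_of_mul_neg hneg).1 (sechPow_pos _ _)
    · exact jost_pos_iff.1 (jost_pos (by linarith) le_rfl _)
  have hk0 : jost s κ₁ (-b) = 0 := by rw [jost, hk, mul_zero]
  have key : ∀ y, jost s (s - 1) y ≠ 0 → ∃ η, 0 < η ∧ ∀ κ, |κ - (s - 1)| < η → jost s κ y ≠ 0 := by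
    intro y hy
    obtain ⟨η, h0, h1⟩ := exists_interval_of_continuousOn
      (continuous_jostFactor_param s (abs_tanhVar_lt y)) hs0 (jost_ne_zero_iff.1 hy)
    exact ⟨η, h0, fun κ hκ => jost_ne_zero_iff.2 (h1 κ hκ)⟩
  have hbpos : jost s (s - 1) b ≠ 0 := by
    rw [jost_sub_one hs]
    exact (mul_pos (sechPow_pos _ _) (tanh_pos hb)).ne'
  obtain ⟨η1, p1, h1⟩ := key b hbpos
  obtain ⟨η2, p2, h2⟩ := key (-b) hneg.ne
  obtain ⟨η3, p3, h3⟩ : ∃ η, 0 < η ∧ ∀ κ, |κ - (s - 1)| < η →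
      0 < hyp (κ - s + 1) (κ + s + 1 + 1) (1 + κ + 1) (1 / 2) := by
    have hc := (continuous_jostFactorDeriv_param s
      (show |(1 / 2 : ℝ)| < 1 by norm_num [abs_lt])).continuousAt (Ioi_mem_nhds hs0)
    have h1 : 0 < hyp (s - 1 - s + 1) (s - 1 + s + 1 + 1) (1 + (s - 1) + 1) (1 / 2) := by
      rw [show s - 1 - s + 1 = 0 by ring, hyp_zero_left]; exact one_pos
    obtain ⟨η, h2, h3⟩ := Metric.eventually_nhds_iff.1 (hc.eventually (lt_mem_nhds h1))
    exact ⟨η, h2, fun t ht => h3 (by rwa [Real.dist_eq])⟩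
  -- The bound `(s - 1) / 2` keeps `κ` positive, and `1 / 2` keeps `κ > s - 2`, as
  -- `jost_zero_ne_zero_of_lt` requires.
  set η := min (min η1 η2) (min η3 (min ((s - 1) / 2) (1 / 2))) with hη
  have e1 := min_le_left (min η1 η2) (min η3 (min ((s - 1) / 2) (1 / 2)))
  have e2 := min_le_right (min η1 η2) (min η3 (min ((s - 1) / 2) (1 / 2)))
  have e3 := min_le_left η1 η2
  have e4 := min_le_right η1 η2
  have e5 := min_le_left η3 (min ((s - 1) / 2) (1 / 2))
  have e6 := min_le_right η3 (min ((s - 1) / 2) (1 / 2))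
  have e7 := min_le_left ((s - 1) / 2) (1 / 2)
  have e8 := min_le_right ((s - 1) / 2) (1 / 2)
  rw [← hη] at e1 e2
  refine ⟨κ₁, η, hk1, hk2, by positivity, by linarith, hk0, fun κ hκ => ?_⟩
  have hκ0 : 0 < κ := by linarith
  have hclose : κ ≤ s - 1 → |κ - (s - 1)| < η := fun h => by rw [abs_lt]; constructor <;> linarith
  have hhyp : 0 < hyp (κ - s + 1) (κ + s + 1 + 1) (1 + κ + 1) (1 / 2) := by
    rcases le_or_gt κ (s - 1) with h | h
    · exact h3 κ ((hclose h).trans_le (by linarith))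
    · refine hyp_pos ?_ ?_ ?_ ?_ ?_ <;> linarith
  have hV : κ ≠ s → jostDeriv s κ 0 ≠ 0 := fun hne =>
    jostDeriv_zero_ne_zero hκ0 (by linarith) hne hhyp.ne'
  refine ⟨?_, ?_, ?_, ?_⟩
  · rcases le_or_gt κ (s - 1) with h | h
    · exact h1 κ ((hclose h).trans_le (by linarith))
    · exact jost_ne_zero_of_nonneg hs h hb.le
  · intro h0
    rcases le_or_gt κ (s - 1) with h | h
    · exact absurd h0 (h2 κ ((hclose h).trans_le (by linarith)))
    rcases le_or_gt s κ with h' | h'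
    · exact absurd h0 (jost_pos (by linarith) h' _).ne'
    -- Uniqueness of `κ₁`: two rates with a common zero at `-b` and positive solutions to its right
    -- would have zero Wronskian there.
    have q := jost_pos_of_zero hκ0 h h' h0
    have q1 := jost_pos_of_zero (by linarith) hk1 hk2 hk0
    rcases lt_trichotomy κ κ₁ with hlt | heq | hlt
    · have := jost_wronskian_neg hκ0 hlt q1 q
      rw [h0, hk0] at this
      simp at this
    · exact heq
    · have := jost_wronskian_neg (by linarith : 0 < κ₁) hlt q q1
      rw [h0, hk0] at this
      simp at this
  · intro h0
    rcases lt_trichotomy κ (s - 1) with h | h | h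
    · exact absurd h0 (jost_zero_ne_zero_of_lt hs hκ0 (by linarith) h hhyp.le)
    · exact h
    · exact absurd h0 (jost_ne_zero_of_nonneg hs h le_rfl)
  · intro h0
    by_contra hne
    exact hV hne h0

/-! ### Classical representatives of solutions of `u'' = Q u` on one edge -/

theorem isPrimitive_of_hasDerivAt {f f' : ℝ → ℂ} (hf : ∀ x, HasDerivAt f (f' x) x)
    (hc : Continuous f') (h0 : MemLp f 2 (volume.restrict (Ioi (0 : ℝ))))
    (h1 : MemLp f' 2 (volume.restrict (Ioi (0 : ℝ)))) :
    IsPrimitive (f 0) (h1.toLp f') (h0.toLp f) := by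
  filter_upwards [h0.coeFn_toLp, ae_restrict_mem measurableSet_Ioi] with x hx hx0
  have hx0 : (0 : ℝ) < x := hx0
  have : ∫ t in (0 : ℝ)..x, (h1.toLp f') t = ∫ t in (0 : ℝ)..x, f' t := by
    apply intervalIntegral.integral_congr_ae
    rw [uIoc_of_le hx0.le, ← ae_restrict_iff' measurableSet_Ioc]
    exact ae_restrict_of_ae_restrict_of_subset Ioc_subset_Ioi_self h1.coeFn_toLp
  rw [hx, this, intervalIntegral.integral_eq_sub_of_hasDerivAt (fun t _ => hf t)
    (hc.intervalIntegrable _ _)]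
  ring

theorem IsPrimitive.mem_H1Edge {b : ℂ} {v u : L2Edge} (h : IsPrimitive b v u) : u ∈ H1Edge :=
  ⟨b, v, h⟩

theorem integral_eq_of_ae_eq_edge {f g : ℝ → ℂ} (h : f =ᵐ[volume.restrict (Ioi (0 : ℝ))] g)
    {x : ℝ} (hx : 0 ≤ x) : ∫ t in (0 : ℝ)..x, f t = ∫ t in (0 : ℝ)..x, g t := by
  apply intervalIntegral.integral_congr_ae
  rw [uIoc_of_le hx, ← ae_restrict_iff' measurableSet_Ioc]
  exact ae_restrict_of_ae_restrict_of_subset Ioc_subset_Ioi_self h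

theorem intervalIntegrable_indicator_edge (v : L2Edge) (x y : ℝ) :
    IntervalIntegrable (indicator (Ioi (0 : ℝ)) (fun t => v t)) volume x y := by
  have : MemLp (indicator (Ioi (0 : ℝ)) (fun t => v t)) 2 volume :=
    (memLp_indicator_iff_restrict measurableSet_Ioi).2 (Lp.memLp v)
  exact ((this.locallyIntegrable (by norm_num)).integrableOn_isCompact
    isCompact_uIcc).intervalIntegrable

/-- Both `f²` and its derivative `2 f f'` are integrable as products of square-integrable functions,
which forces `f² → 0`. -/
theorem tendsto_zero_of_memLp_two {f f' : ℝ → ℂ} (hf : ∀ x ∈ Ioi (0 : ℝ), HasDerivAt f (f' x) x)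
    (h0 : MemLp f 2 (volume.restrict (Ioi (0 : ℝ))))
    (h1 : MemLp f' 2 (volume.restrict (Ioi (0 : ℝ)))) :
    Filter.Tendsto f Filter.atTop (nhds 0) := by
  have hint : Integrable (fun x => f x * f x) (volume.restrict (Ioi (0 : ℝ))) :=
    h0.integrable_mul h0
  have hint' : Integrable (fun x => f' x * f x + f x * f' x) (volume.restrict (Ioi (0 : ℝ))) :=
    (h1.integrable_mul h0).add (h0.integrable_mul h1)
  have h := tendsto_zero_of_hasDerivAt_of_integrableOn_Ioi (a := 0)
    (fun x hx => (hf x hx).mul (hf x hx)) hint' hint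
  have h2 := (h.norm).sqrt
  rw [tendsto_zero_iff_norm_tendsto_zero]
  simpa [Real.sqrt_mul_self] using h2

/-- A classical solution of `f'' = Q f` on `[0, ∞)` that decays at `+∞` with its derivative. -/
structure IsDecayingSolution (Q f f' : ℝ → ℂ) : Prop where
  hasDerivAt : ∀ x, 0 < x → HasDerivAt f (f' x) x
  hasDerivAt' : ∀ x, 0 < x → HasDerivAt f' (Q x * f x) x
  continuousOn : ContinuousOn f (Ici 0)
  continuousOn' : ContinuousOn f' (Ici 0)
  tendsto : Filter.Tendsto f Filter.atTop (nhds 0)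
  tendsto' : Filter.Tendsto f' Filter.atTop (nhds 0)

/-- Elliptic regularity in one dimension: integrating the weak derivatives gives continuous
representatives, and the equation then makes the second derivative continuous. -/
theorem exists_isDecayingSolution {Q : ℝ → ℂ} (hQ : Continuous Q) {u : L2Edge} (hu : u ∈ H2Edge)
    (h : ∀ᵐ x ∂(volume.restrict (Ioi (0 : ℝ))), weakDeriv (weakDeriv u) x = Q x * u x) :
    ∃ f f' : ℝ → ℂ, IsDecayingSolution Q f f' ∧ f 0 = trace u ∧ f' 0 = trace (weakDeriv u) ∧
      u =ᵐ[volume.restrict (Ioi (0 : ℝ))] f := by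
  set v := weakDeriv u
  set w := weakDeriv v
  have hu1 : IsPrimitive (trace u) v u := isPrimitive_of_mem hu.1
  have hv1 : IsPrimitive (trace v) w v := isPrimitive_of_mem hu.2
  set g₀ : ℝ → ℂ := fun x => trace v + ∫ t in (0 : ℝ)..x, indicator (Ioi (0 : ℝ)) (fun t => w t) t
  have hg₀ : Continuous g₀ := continuous_const.add
    (intervalIntegral.continuous_primitive (intervalIntegrable_indicator_edge w) 0)
  have hind : indicator (Ioi (0 : ℝ)) (fun t => w t) =ᵐ[volume.restrict (Ioi (0 : ℝ))] w :=
    indicator_ae_eq_restrict measurableSet_Ioi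
  have hvg : v =ᵐ[volume.restrict (Ioi (0 : ℝ))] g₀ := by
    filter_upwards [hv1, ae_restrict_mem measurableSet_Ioi] with x hx hx0
    rw [hx, ← integral_eq_of_ae_eq_edge hind (le_of_lt hx0)]
  set f : ℝ → ℂ := fun x => trace u + ∫ t in (0 : ℝ)..x, g₀ t
  have hfd : ∀ x, HasDerivAt f (g₀ x) x := fun x =>
    ((hg₀.integral_hasStrictDerivAt 0 x).hasDerivAt).const_add _
  have hfc : Continuous f := continuous_iff_continuousAt.2 fun x => (hfd x).continuousAt
  have huf : u =ᵐ[volume.restrict (Ioi (0 : ℝ))] f := by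
    filter_upwards [hu1, ae_restrict_mem measurableSet_Ioi] with x hx hx0
    rw [hx, integral_eq_of_ae_eq_edge hvg (le_of_lt hx0)]
  have hwf : w =ᵐ[volume.restrict (Ioi (0 : ℝ))] fun x => Q x * f x := by
    filter_upwards [h, huf] with x hx hx'
    rw [hx, hx']
  -- `g₀` integrates a function known only almost everywhere. `g` agrees with it on `[0, ∞)` and has
  -- the derivative `Q f` at every point.
  set g : ℝ → ℂ := fun x => trace v + ∫ t in (0 : ℝ)..x, Q t * f t
  have hgd : ∀ x, HasDerivAt g (Q x * f x) x := fun x =>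
    (((hQ.mul hfc).integral_hasStrictDerivAt 0 x).hasDerivAt).const_add _
  have hgg : ∀ x, 0 ≤ x → g₀ x = g x := fun x hx => by
    simp only [g₀, g]
    rw [integral_eq_of_ae_eq_edge hind hx, integral_eq_of_ae_eq_edge hwf hx]
  have hfL : MemLp f 2 (volume.restrict (Ioi (0 : ℝ))) := (memLp_congr_ae huf).1 (Lp.memLp u)
  have hgL : MemLp g 2 (volume.restrict (Ioi (0 : ℝ))) := by
    refine (memLp_congr_ae (hvg.trans ?_)).1 (Lp.memLp v)
    filter_upwards [ae_restrict_mem measurableSet_Ioi] with x hx using hgg x (le_of_lt hx)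
  have hwL : MemLp (fun x => Q x * f x) 2 (volume.restrict (Ioi (0 : ℝ))) :=
    (memLp_congr_ae hwf).1 (Lp.memLp w)
  have hfd' : ∀ x, 0 < x → HasDerivAt f (g x) x := fun x hx => by
    rw [← hgg x hx.le]; exact hfd x
  refine ⟨f, g, ⟨hfd', fun x _ => hgd x, hfc.continuousOn,
    fun x _ => (hgd x).continuousAt.continuousWithinAt,
    tendsto_zero_of_memLp_two hfd' hfL hgL,
    tendsto_zero_of_memLp_two (fun x _ => hgd x) hgL hwL⟩, ?_, ?_, huf⟩
  · simp [f]
  · simp [g]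

/-- Uniqueness for the Cauchy problem of `f'' = Q f` at the vertex. -/
theorem eq_zero_of_cauchy_data {Q f g : ℝ → ℂ} {M : ℝ} (hQ : ∀ x, ‖Q x‖ ≤ M)
    (hf : ∀ x, 0 < x → HasDerivAt f (g x) x) (hg : ∀ x, 0 < x → HasDerivAt g (Q x * f x) x)
    (hfc : ContinuousOn f (Ici 0)) (hgc : ContinuousOn g (Ici 0)) (hf0 : f 0 = 0) (hg0 : g 0 = 0)
    {x : ℝ} (hx : 0 ≤ x) : f x = 0 ∧ g x = 0 := by
  have hM : 0 ≤ M := (norm_nonneg _).trans (hQ 0)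
  -- Grönwall's argument: the derivative of `‖f‖² + ‖g‖²` is at most `2 (1 + M) ‖f‖ ‖g‖ ≤ (1 + M)
  -- (‖f‖² + ‖g‖²)`, so this weight makes the energy non-increasing from the value `0`.
  set E : ℝ → ℝ := fun x => (‖f x‖ ^ 2 + ‖g x‖ ^ 2) * Real.exp (-(1 + M) * x) with hE
  have hd : ∀ x, 0 < x → HasDerivAt E ((2 * inner ℝ (f x) (g x) + 2 * inner ℝ (g x) (Q x * f x)
      - (1 + M) * (‖f x‖ ^ 2 + ‖g x‖ ^ 2)) * Real.exp (-(1 + M) * x)) x := by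
    intro x hx
    have h1 := ((hasDerivAt_id x).const_mul (-(1 + M))).exp
    refine (((hf x hx).norm_sq.add (hg x hx).norm_sq).mul h1).congr_deriv ?_
    simp only [id, Pi.add_apply]
    ring
  have hanti : AntitoneOn E (Ici 0) := by
    refine antitoneOn_of_deriv_nonpos (convex_Ici 0) ?_
      (fun x hx => (hd x (by simpa using hx)).differentiableAt.differentiableWithinAt) fun x hx => ?_
    · exact ((hfc.norm.pow 2).add (hgc.norm.pow 2)).mul (by fun_prop)
    · rw [interior_Ici] at hx
      rw [(hd x hx).deriv]
      refine mul_nonpos_of_nonpos_of_nonneg ?_ (Real.exp_pos _).le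
      have h1 := real_inner_le_norm (f x) (g x)
      have h2 := real_inner_le_norm (g x) (Q x * f x)
      rw [norm_mul] at h2
      have h3 : ‖g x‖ * (‖Q x‖ * ‖f x‖) ≤ ‖g x‖ * (M * ‖f x‖) := by
        gcongr
        exact hQ x
      nlinarith [mul_nonneg hM (sq_nonneg (‖f x‖ - ‖g x‖)), sq_nonneg (‖f x‖ - ‖g x‖)]
  have h := hanti self_mem_Ici (show x ∈ Ici (0 : ℝ) from hx) hx
  have hle : ‖f x‖ ^ 2 + ‖g x‖ ^ 2 ≤ 0 := by
    have : E 0 = 0 := by simp [hE, hf0, hg0]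
    rw [this] at h
    exact nonpos_of_mul_nonpos_left h (Real.exp_pos _)
  constructor
  · rw [← norm_eq_zero]; nlinarith [sq_nonneg ‖f x‖, sq_nonneg ‖g x‖]
  · rw [← norm_eq_zero]; nlinarith [sq_nonneg ‖f x‖, sq_nonneg ‖g x‖]

/-- Two decaying solutions have vanishing Wronskian at the vertex. -/
theorem IsDecayingSolution.wronskian_eq_zero {Q f f' g g' : ℝ → ℂ}
    (hf : IsDecayingSolution Q f f') (hg : IsDecayingSolution Q g g') :
    f 0 * g' 0 - f' 0 * g 0 = 0 := by
  set W : ℝ → ℂ := fun x => f x * g' x - f' x * g x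
  have hd : ∀ x, 0 < x → HasDerivAt W 0 x := fun x hx => by
    refine (((hf.hasDerivAt x hx).mul (hg.hasDerivAt' x hx)).sub
      ((hf.hasDerivAt' x hx).mul (hg.hasDerivAt x hx))).congr_deriv ?_
    ring
  have hc : ContinuousOn W (Ici 0) :=
    (hf.continuousOn.mul hg.continuousOn').sub (hf.continuousOn'.mul hg.continuousOn)
  have hconst : ∀ y x, 0 < y → y ≤ x → W x = W y := fun y x hy hx =>
    constant_of_has_deriv_right_zero
      (hc.mono fun t ht => hy.le.trans ht.1)
      (fun t ht => (hd t (hy.trans_le ht.1)).hasDerivWithinAt) x ⟨hx, le_rfl⟩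
  have hlim : Filter.Tendsto W Filter.atTop (nhds 0) := by
    simpa using (hf.tendsto.mul hg.tendsto').sub (hf.tendsto'.mul hg.tendsto)
  have hz : EqOn W (fun _ => 0) (Ioi 0) := fun y hy => by
    refine tendsto_nhds_unique (f := fun _ : ℝ => W y) (l := Filter.atTop) tendsto_const_nhds ?_
    refine hlim.congr' ?_
    filter_upwards [Filter.eventually_ge_atTop y] with x hx using hconst y x hy hx
  exact hz.of_subset_closure hc continuousOn_const Ioi_subset_Ici_self
    (by rw [closure_Ioi]) self_mem_Ici

/-- If `g` has non-zero Cauchy data at the vertex, every decaying solution is a multiple of `g`. -/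
theorem IsDecayingSolution.exists_eq_smul {Q f f' g g' : ℝ → ℂ} {M : ℝ} (hQ : ∀ x, ‖Q x‖ ≤ M)
    (hf : IsDecayingSolution Q f f') (hg : IsDecayingSolution Q g g')
    (hne : ∃ x, 0 ≤ x ∧ g x ≠ 0) : ∃ c : ℂ, ∀ x, 0 ≤ x → f x = c * g x := by
  have hW := hf.wronskian_eq_zero hg
  -- The factor is the ratio of the values at `0`, or of the derivatives if `g 0 = 0`; the vanishing
  -- Wronskian matches the other Cauchy datum.
  have key : ∀ c : ℂ, f 0 = c * g 0 → f' 0 = c * g' 0 → ∀ x, 0 ≤ x → f x = c * g x := by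
    intro c h0 h1 x hx
    have := (eq_zero_of_cauchy_data (f := fun x => f x - c * g x) (g := fun x => f' x - c * g' x)
      hQ (fun x hx => (hf.hasDerivAt x hx).sub ((hg.hasDerivAt x hx).const_mul c))
      (fun x hx => ((hf.hasDerivAt' x hx).sub ((hg.hasDerivAt' x hx).const_mul c)).congr_deriv
        (by ring)) (hf.continuousOn.sub (hg.continuousOn.const_mul c))
      (hf.continuousOn'.sub (hg.continuousOn'.const_mul c)) (by simp [h0]) (by simp [h1]) hx).1
    exact sub_eq_zero.1 this
  by_cases h0 : g 0 = 0
  · by_cases h1 : g' 0 = 0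
    · obtain ⟨x, hx, hgx⟩ := hne
      exact absurd (eq_zero_of_cauchy_data hQ hg.hasDerivAt hg.hasDerivAt' hg.continuousOn
        hg.continuousOn' h0 h1 hx).1 hgx
    · refine ⟨f' 0 / g' 0, key _ ?_ (by field_simp)⟩
      field_simp
      linear_combination hW
  · refine ⟨f 0 / g 0, key _ (by field_simp) ?_⟩
    field_simp
    linear_combination -hW

/-! ### The decaying solution on one edge -/

/-- The decaying solution `x ↦ U (p (x + τ))` on an edge with shift `τ`. -/
def edgeFun (s κ p τ x : ℝ) : ℂ := ((jost s κ (p * (x + τ)) : ℝ) : ℂ)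

/-- The derivative of `edgeFun`. -/
def edgeFunDeriv (s κ p τ x : ℝ) : ℂ := ((p * jostDeriv s κ (p * (x + τ)) : ℝ) : ℂ)

/-- The coefficient `Q` of the equation `f'' = Q f` satisfied by `edgeFun`. -/
def edgeCoeff (s κ p τ x : ℝ) : ℂ :=
  ((p ^ 2 * (κ ^ 2 - s * (s + 1) * (1 - Real.tanh (p * (x + τ)) ^ 2)) : ℝ) : ℂ)

theorem hasDerivAt_scaling (p τ x : ℝ) : HasDerivAt (fun x => p * (x + τ)) p x := by
  simpa using ((hasDerivAt_id x).add_const τ).const_mul p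

theorem hasDerivAt_edgeFun {s κ : ℝ} (hκ : 0 < κ) (p τ x : ℝ) :
    HasDerivAt (edgeFun s κ p τ) (edgeFunDeriv s κ p τ x) x := by
  have h := ((hasDerivAt_jost (s := s) hκ (p * (x + τ))).comp x
    (hasDerivAt_scaling p τ x)).ofReal_comp
  refine h.congr_deriv ?_
  rw [edgeFunDeriv, mul_comm]

theorem hasDerivAt_edgeFunDeriv {s κ : ℝ} (hκ : 0 < κ) (p τ x : ℝ) :
    HasDerivAt (edgeFunDeriv s κ p τ) (edgeCoeff s κ p τ x * edgeFun s κ p τ x) x := by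
  have h := (((hasDerivAt_jostDeriv (s := s) hκ (p * (x + τ))).comp x
    (hasDerivAt_scaling p τ x)).const_mul p).ofReal_comp
  refine h.congr_deriv ?_
  rw [edgeCoeff, edgeFun, ← Complex.ofReal_mul]
  congr 1
  ring

theorem continuous_tanh : Continuous Real.tanh :=
  continuous_iff_continuousAt.2 fun y => (hasDerivAt_tanh y).continuousAt

theorem continuous_edgeCoeff (s κ p τ : ℝ) : Continuous (edgeCoeff s κ p τ) := by
  have := continuous_tanh
  unfold edgeCoeff
  fun_prop

theorem norm_edgeCoeff_le (s κ p τ x : ℝ) :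
    ‖edgeCoeff s κ p τ x‖ ≤ p ^ 2 * (κ ^ 2 + |s * (s + 1)|) := by
  rw [edgeCoeff, Complex.norm_real, Real.norm_eq_abs, abs_mul, abs_of_nonneg (sq_nonneg p)]
  gcongr
  refine (abs_sub _ _).trans ?_
  rw [abs_of_nonneg (sq_nonneg κ), abs_mul]
  have h1 := Real.tanh_sq_lt_one (p * (x + τ))
  have h2 := sq_nonneg (Real.tanh (p * (x + τ)))
  have h3 : |1 - Real.tanh (p * (x + τ)) ^ 2| ≤ 1 := by rw [abs_le]; constructor <;> linarith
  have := mul_le_mul_of_nonneg_left h3 (abs_nonneg (s * (s + 1)))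
  linarith

theorem memLp_two_of_exp_bound {f : ℝ → ℝ} {p κ τ C : ℝ} (hp : 0 < p) (hκ : 0 < κ)
    (hf : Continuous f) (h : ∀ y, p * τ ≤ y → |f y| ≤ C * Real.exp (-κ * y)) :
    MemLp (fun x => ((f (p * (x + τ)) : ℝ) : ℂ)) 2 (volume.restrict (Ioi (0 : ℝ))) := by
  have hexp : MemLp (fun x : ℝ => C * Real.exp (-κ * (p * τ)) * Real.exp (-(κ * p) * x)) 2
      (volume.restrict (Ioi (0 : ℝ))) := by
    refine MemLp.const_mul ?_ _
    rw [memLp_two_iff_integrable_sq (by fun_prop)]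
    have := exp_neg_integrableOn_Ioi 0 (by positivity : 0 < 2 * (κ * p))
    refine this.congr (Filter.Eventually.of_forall fun x => ?_)
    simp only [sq, ← Real.exp_add]
    congr 1
    ring
  refine hexp.mono (by fun_prop) ?_
  filter_upwards [ae_restrict_mem measurableSet_Ioi] with x hx
  have hx : (0 : ℝ) < x := hx
  rw [Complex.norm_real, Real.norm_eq_abs]
  refine (h _ (by nlinarith)).trans (le_trans (le_of_eq ?_) (le_abs_self _))
  rw [mul_assoc, ← Real.exp_add]
  congr 2
  ring

theorem continuous_jost {s κ : ℝ} (hκ : 0 < κ) : Continuous (jost s κ) :=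
  continuous_iff_continuousAt.2 fun y => (hasDerivAt_jost hκ y).continuousAt

theorem continuous_jostDeriv {s κ : ℝ} (hκ : 0 < κ) : Continuous (jostDeriv s κ) :=
  continuous_iff_continuousAt.2 fun y => (hasDerivAt_jostDeriv hκ y).continuousAt

theorem memLp_edgeFun (s : ℝ) {κ p : ℝ} (hκ : 0 < κ) (hp : 0 < p) (τ : ℝ) :
    MemLp (edgeFun s κ p τ) 2 (volume.restrict (Ioi (0 : ℝ))) := by
  obtain ⟨C, hC⟩ := jost_exp_bound s hκ (p * τ)
  exact memLp_two_of_exp_bound hp hκ (continuous_jost hκ) fun y hy => (hC y hy).1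

theorem memLp_edgeFunDeriv (s : ℝ) {κ p : ℝ} (hκ : 0 < κ) (hp : 0 < p) (τ : ℝ) :
    MemLp (edgeFunDeriv s κ p τ) 2 (volume.restrict (Ioi (0 : ℝ))) := by
  obtain ⟨C, hC⟩ := jost_exp_bound s hκ (p * τ)
  have := (memLp_two_of_exp_bound hp hκ (continuous_jostDeriv hκ)
    fun y hy => (hC y hy).2).const_mul (p : ℂ)
  refine (memLp_congr_ae (Filter.Eventually.of_forall fun x => ?_)).1 this
  simp [edgeFunDeriv]

theorem continuous_edgeFun {s κ : ℝ} (hκ : 0 < κ) (p τ : ℝ) : Continuous (edgeFun s κ p τ) :=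
  continuous_iff_continuousAt.2 fun x => (hasDerivAt_edgeFun hκ p τ x).continuousAt

theorem continuous_edgeFunDeriv {s κ : ℝ} (hκ : 0 < κ) (p τ : ℝ) :
    Continuous (edgeFunDeriv s κ p τ) :=
  continuous_iff_continuousAt.2 fun x => (hasDerivAt_edgeFunDeriv hκ p τ x).continuousAt

theorem memLp_edgeFunSecondDeriv (s : ℝ) {κ p : ℝ} (hκ : 0 < κ) (hp : 0 < p) (τ : ℝ) :
    MemLp (fun x => edgeCoeff s κ p τ x * edgeFun s κ p τ x) 2
      (volume.restrict (Ioi (0 : ℝ))) := by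
  refine (memLp_edgeFun s hκ hp τ).of_le_mul (c := p ^ 2 * (κ ^ 2 + |s * (s + 1)|))
    (((continuous_edgeCoeff s κ p τ).mul (continuous_edgeFun hκ p τ)).aestronglyMeasurable)
    (Filter.Eventually.of_forall fun x => ?_)
  rw [norm_mul]
  exact mul_le_mul_of_nonneg_right (norm_edgeCoeff_le s κ p τ x) (norm_nonneg _)

/-- The decaying solution on an edge as an element of `L²(ℝ⁺)`. -/
def edgeState (s : ℝ) {κ p : ℝ} (hκ : 0 < κ) (hp : 0 < p) (τ : ℝ) : L2Edge :=
  (memLp_edgeFun s hκ hp τ).toLp _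

theorem coeFn_edgeState (s : ℝ) {κ p : ℝ} (hκ : 0 < κ) (hp : 0 < p) (τ : ℝ) :
    edgeState s hκ hp τ =ᵐ[volume.restrict (Ioi (0 : ℝ))] edgeFun s κ p τ :=
  (memLp_edgeFun s hκ hp τ).coeFn_toLp

theorem isPrimitive_edgeState (s : ℝ) {κ p : ℝ} (hκ : 0 < κ) (hp : 0 < p) (τ : ℝ) :
    IsPrimitive (edgeFun s κ p τ 0) ((memLp_edgeFunDeriv s hκ hp τ).toLp _)
      (edgeState s hκ hp τ) :=
  isPrimitive_of_hasDerivAt (hasDerivAt_edgeFun hκ p τ) (continuous_edgeFunDeriv hκ p τ) _ _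

theorem isPrimitive_edgeStateDeriv (s : ℝ) {κ p : ℝ} (hκ : 0 < κ) (hp : 0 < p) (τ : ℝ) :
    IsPrimitive (edgeFunDeriv s κ p τ 0) ((memLp_edgeFunSecondDeriv s hκ hp τ).toLp _)
      ((memLp_edgeFunDeriv s hκ hp τ).toLp _) :=
  isPrimitive_of_hasDerivAt (hasDerivAt_edgeFunDeriv hκ p τ)
    ((continuous_edgeCoeff s κ p τ).mul (continuous_edgeFun hκ p τ)) _ _

theorem trace_edgeState (s : ℝ) {κ p : ℝ} (hκ : 0 < κ) (hp : 0 < p) (τ : ℝ) :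
    trace (edgeState s hκ hp τ) = ((jost s κ (p * τ) : ℝ) : ℂ) := by
  rw [(isPrimitive_edgeState s hκ hp τ).trace_eq, edgeFun, zero_add]

theorem trace_weakDeriv_edgeState (s : ℝ) {κ p : ℝ} (hκ : 0 < κ) (hp : 0 < p) (τ : ℝ) :
    trace (weakDeriv (edgeState s hκ hp τ)) = ((p * jostDeriv s κ (p * τ) : ℝ) : ℂ) := by
  rw [(isPrimitive_edgeState s hκ hp τ).weakDeriv_eq,
    (isPrimitive_edgeStateDeriv s hκ hp τ).trace_eq, edgeFunDeriv, zero_add]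

theorem edgeState_mem (s : ℝ) {κ p : ℝ} (hκ : 0 < κ) (hp : 0 < p) (τ : ℝ) :
    edgeState s hκ hp τ ∈ H2Edge := by
  refine ⟨(isPrimitive_edgeState s hκ hp τ).mem_H1Edge, ?_⟩
  rw [(isPrimitive_edgeState s hκ hp τ).weakDeriv_eq]
  exact (isPrimitive_edgeStateDeriv s hκ hp τ).mem_H1Edge

theorem weakDeriv_weakDeriv_edgeState (s : ℝ) {κ p : ℝ} (hκ : 0 < κ) (hp : 0 < p) (τ : ℝ) :
    ∀ᵐ x ∂(volume.restrict (Ioi (0 : ℝ))), weakDeriv (weakDeriv (edgeState s hκ hp τ)) x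
      = edgeCoeff s κ p τ x * edgeState s hκ hp τ x := by
  rw [(isPrimitive_edgeState s hκ hp τ).weakDeriv_eq,
    (isPrimitive_edgeStateDeriv s hκ hp τ).weakDeriv_eq]
  filter_upwards [coeFn_edgeState s hκ hp τ,
    (memLp_edgeFunSecondDeriv s hκ hp τ).coeFn_toLp] with x h1 h2
  rw [h1, h2]

theorem tendsto_scaling {p : ℝ} (hp : 0 < p) (τ : ℝ) :
    Filter.Tendsto (fun x => p * (x + τ)) Filter.atTop Filter.atTop :=
  (Filter.tendsto_atTop_add_const_right _ _ Filter.tendsto_id).const_mul_atTop hp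

theorem isDecayingSolution_edgeFun (s : ℝ) {κ p : ℝ} (hκ : 0 < κ) (hp : 0 < p) (τ : ℝ) :
    IsDecayingSolution (edgeCoeff s κ p τ) (edgeFun s κ p τ) (edgeFunDeriv s κ p τ) where
  hasDerivAt x _ := hasDerivAt_edgeFun hκ p τ x
  hasDerivAt' x _ := hasDerivAt_edgeFunDeriv hκ p τ x
  continuousOn := (continuous_edgeFun hκ p τ).continuousOn
  continuousOn' := (continuous_edgeFunDeriv hκ p τ).continuousOn
  tendsto := by
    have h := (Complex.continuous_ofReal.tendsto 0).comp
      ((tendsto_jost s hκ).comp (tendsto_scaling hp τ))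
    rw [Complex.ofReal_zero] at h
    exact h
  tendsto' := by
    have h := (Complex.continuous_ofReal.tendsto _).comp
      (((tendsto_jostDeriv s hκ).comp (tendsto_scaling hp τ)).const_mul p)
    rw [mul_zero, Complex.ofReal_zero] at h
    exact h

theorem exists_edgeFun_ne_zero (s : ℝ) {κ p : ℝ} (hκ : 0 < κ) (hp : 0 < p) (τ : ℝ) :
    ∃ x, 0 < x ∧ edgeFun s κ p τ x ≠ 0 := by
  obtain ⟨x, hx, h⟩ := (((tendsto_scaling hp τ).eventually (eventually_jost_pos s hκ)).and
    (Filter.eventually_gt_atTop 0)).exists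
  exact ⟨x, h, Complex.ofReal_ne_zero.2 hx.ne'⟩

theorem edgeState_ne_zero (s : ℝ) {κ p : ℝ} (hκ : 0 < κ) (hp : 0 < p) (τ : ℝ) :
    edgeState s hκ hp τ ≠ 0 := by
  intro h0
  have h := coeFn_edgeState s hκ hp τ
  rw [h0] at h
  have h' : edgeFun s κ p τ =ᵐ[volume.restrict (Ioi (0 : ℝ))] fun _ => 0 :=
    h.symm.trans (Lp.coeFn_zero _ _ _)
  have hEq := Measure.eqOn_open_of_ae_eq h' isOpen_Ioi
    (continuous_edgeFun hκ p τ).continuousOn continuousOn_const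
  obtain ⟨x, hx, hne⟩ := exists_edgeFun_ne_zero s hκ hp τ
  exact hne (hEq hx)

/-- Every `H²` solution on an edge is a multiple of `edgeState`. -/
theorem exists_eq_smul_edgeState (s : ℝ) {κ p : ℝ} (hκ : 0 < κ) (hp : 0 < p) (τ : ℝ) {u : L2Edge}
    (hu : u ∈ H2Edge) (h : ∀ᵐ x ∂(volume.restrict (Ioi (0 : ℝ))),
      weakDeriv (weakDeriv u) x = edgeCoeff s κ p τ x * u x) :
    ∃ c : ℂ, u = c • edgeState s hκ hp τ := by
  obtain ⟨f, f', hf, -, -, huf⟩ := exists_isDecayingSolution (continuous_edgeCoeff s κ p τ) hu h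
  obtain ⟨x, hx, hne⟩ := exists_edgeFun_ne_zero s hκ hp τ
  obtain ⟨c, hc⟩ := hf.exists_eq_smul (norm_edgeCoeff_le s κ p τ)
    (isDecayingSolution_edgeFun s hκ hp τ) ⟨x, hx.le, hne⟩
  refine ⟨c, Lp.ext ?_⟩
  filter_upwards [huf, Lp.coeFn_smul c (edgeState s hκ hp τ), coeFn_edgeState s hκ hp τ,
    ae_restrict_mem measurableSet_Ioi] with x h1 h2 h3 hx
  rw [h1, h2, Pi.smul_apply, h3, smul_eq_mul, hc x (le_of_lt hx)]

/-! ### The matching conditions at the vertex -/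

/-- The amplitudes `c` on the edges for which the states with boundary values `cⱼ Uⱼ` and boundary
derivatives `cⱼ Vⱼ` satisfy the vertex conditions with weights `r`. -/
def matchSpace {ι : Type*} [Fintype ι] (r U V : ι → ℝ) : Submodule ℂ (ι → ℂ) where
  carrier := {c | (∀ i j, (r i : ℂ) * (c i * U i) = (r j : ℂ) * (c j * U j)) ∧
    ∑ j, ((1 / r j : ℝ) : ℂ) * (c j * V j) = 0}
  add_mem' := by
    rintro c d ⟨h1, h2⟩ ⟨h1', h2'⟩
    refine ⟨fun i j => ?_, ?_⟩
    · simp only [Pi.add_apply]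
      linear_combination h1 i j + h1' i j
    · simp only [Pi.add_apply, add_mul, mul_add]
      rw [Finset.sum_add_distrib, h2, h2', add_zero]
  zero_mem' := by simp
  smul_mem' := by
    rintro z c ⟨h1, h2⟩
    refine ⟨fun i j => ?_, ?_⟩
    · simp only [Pi.smul_apply, smul_eq_mul]
      linear_combination z * h1 i j
    · simp only [Pi.smul_apply, smul_eq_mul]
      rw [← mul_zero z, ← h2, Finset.mul_sum]
      exact Finset.sum_congr rfl fun j _ => by ring

section Matching

variable {ι : Type*} [Fintype ι] {P : ι → Prop} [DecidablePred P] {r : ι → ℝ} {u u' v v' : ℝ}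

theorem sum_matching (hbal : ∑ j with P j, 1 / r j ^ 2 = ∑ j with ¬ P j, 1 / r j ^ 2) (x y : ℝ) :
    ∑ j, 1 / r j ^ 2 * (if P j then x else y) = (∑ j with P j, 1 / r j ^ 2) * (x + y) := by
  rw [← Finset.sum_filter_add_sum_filter_not Finset.univ P, mul_add]
  nth_rewrite 2 [hbal]
  rw [Finset.sum_mul, Finset.sum_mul]
  congr 1
  · refine Finset.sum_congr rfl fun j hj => ?_
    rw [if_pos (Finset.mem_filter.1 hj).2]
  · refine Finset.sum_congr rfl fun j hj => ?_
    rw [if_neg (Finset.mem_filter.1 hj).2]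

theorem sum_matching_pos (hr : ∀ j, 0 < r j) (hP : ∃ j, P j) :
    0 < ∑ j with P j, 1 / r j ^ 2 := by
  obtain ⟨j, hj⟩ := hP
  refine Finset.sum_pos (fun j _ => ?_) ⟨j, by simpa using hj⟩
  have := hr j
  positivity

/-- The parameter `t` is the common weighted value at the vertex and determines all amplitudes. By
the balance of the weights the Kirchhoff sum equals `t R (v / u + v' / u')`, where `R > 0` is the
weight of either half, so only the Wronskian-type numerator matters. -/
theorem mem_matchSpace_iff (hr : ∀ j, 0 < r j) (hu : u ≠ 0) (hu' : u' ≠ 0)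
    (hbal : ∑ j with P j, 1 / r j ^ 2 = ∑ j with ¬ P j, 1 / r j ^ 2) (hP : ∃ j, P j) (c : ι → ℂ) :
    c ∈ matchSpace r (fun j => if P j then u else u') (fun j => if P j then v else v') ↔
      ∃ t : ℂ, (∀ j, c j = t * ((1 / (r j * (if P j then u else u')) : ℝ) : ℂ)) ∧
        t * ((u' * v + v' * u : ℝ) : ℂ) = 0 := by
  have hU : ∀ j, ((if P j then u else u' : ℝ) : ℂ) ≠ 0 := fun j => by
    split_ifs <;> exact Complex.ofReal_ne_zero.2 ‹_›
  have hrC : ∀ j, (r j : ℂ) ≠ 0 := fun j => Complex.ofReal_ne_zero.2 (hr j).ne'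
  have hR := sum_matching_pos hr hP
  have hsum : ∀ t : ℂ, (∀ j, c j = t * ((1 / (r j * (if P j then u else u')) : ℝ) : ℂ)) →
      ∑ j, ((1 / r j : ℝ) : ℂ) * (c j * ((if P j then v else v' : ℝ) : ℂ))
        = t * (((∑ j with P j, 1 / r j ^ 2) * (v / u + v' / u') : ℝ) : ℂ) := by
    intro t ht
    rw [← sum_matching hbal, Complex.ofReal_sum, Finset.mul_sum]
    refine Finset.sum_congr rfl fun j _ => ?_
    rw [ht j]
    have h1 := hrC j
    have h2 := hU j
    split_ifs at h2 ⊢ <;> push_cast <;> field_simp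
  have hW : v / u + v' / u' = (u' * v + v' * u) / (u * u') := by field_simp
  have hiff : ∀ t : ℂ, t * (((∑ j with P j, 1 / r j ^ 2) * (v / u + v' / u') : ℝ) : ℂ) = 0 ↔
      t * ((u' * v + v' * u : ℝ) : ℂ) = 0 := by
    intro t
    rw [hW, mul_eq_zero, mul_eq_zero, Complex.ofReal_eq_zero, Complex.ofReal_eq_zero,
      mul_eq_zero, div_eq_zero_iff, or_iff_right hR.ne', or_iff_left (mul_ne_zero hu hu')]
  constructor
  · rintro ⟨h1, h2⟩
    obtain ⟨i, -⟩ := hP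
    have ht : ∀ j, c j = ((r i : ℂ) * (c i * ((if P i then u else u' : ℝ) : ℂ)))
        * ((1 / (r j * (if P j then u else u')) : ℝ) : ℂ) := fun j => by
      rw [h1 i j]
      have h1 := hrC j
      have h2 := hU j
      push_cast at h2 ⊢
      field_simp
    refine ⟨_, ht, ?_⟩
    rw [hsum _ ht] at h2
    exact (hiff _).1 h2
  · rintro ⟨t, h1, h2⟩
    have h3 : ∀ j, (r j : ℂ) * (c j * ((if P j then u else u' : ℝ) : ℂ)) = t := fun j => by
      rw [h1 j]
      have h1 := hrC j
      have h2 := hU j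
      push_cast at h2 ⊢
      field_simp
    refine ⟨fun i j => by rw [h3 i, h3 j], ?_⟩
    rw [hsum t h1]
    exact (hiff t).2 h2

theorem matchSpace_eq_bot (hr : ∀ j, 0 < r j) (hu : u ≠ 0) (hu' : u' ≠ 0)
    (hW : u' * v + v' * u ≠ 0)
    (hbal : ∑ j with P j, 1 / r j ^ 2 = ∑ j with ¬ P j, 1 / r j ^ 2) (hP : ∃ j, P j) :
    matchSpace r (fun j => if P j then u else u') (fun j => if P j then v else v') = ⊥ := by
  refine (Submodule.eq_bot_iff _).2 fun c hc => ?_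
  obtain ⟨t, h1, h2⟩ := (mem_matchSpace_iff hr hu hu' hbal hP c).1 hc
  have ht : t = 0 := (mul_eq_zero.1 h2).resolve_right (Complex.ofReal_ne_zero.2 hW)
  funext j
  rw [h1 j, ht, zero_mul, Pi.zero_apply]

theorem finrank_matchSpace_eq_one (hr : ∀ j, 0 < r j) (hu : u ≠ 0) (hu' : u' ≠ 0)
    (hW : u' * v + v' * u = 0)
    (hbal : ∑ j with P j, 1 / r j ^ 2 = ∑ j with ¬ P j, 1 / r j ^ 2) (hP : ∃ j, P j) :
    Module.finrank ℂ
      (matchSpace r (fun j => if P j then u else u') (fun j => if P j then v else v')) = 1 := by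
  have hmem := mem_matchSpace_iff (v := v) (v' := v') hr hu hu' hbal hP
  refine finrank_eq_one ⟨fun j => ((1 / (r j * (if P j then u else u')) : ℝ) : ℂ),
    (hmem _).2 ⟨1, fun j => (one_mul _).symm, by rw [hW]; simp⟩⟩ ?_ ?_
  · intro h0
    obtain ⟨i, hi⟩ := hP
    have := congrFun (congrArg Subtype.val h0) i
    simp [hi, (hr i).ne', hu] at this
  · rintro ⟨c, hc⟩
    obtain ⟨t, h1, -⟩ := (hmem c).1 hc
    exact ⟨t, Subtype.ext (funext fun j => (h1 j).symm)⟩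

/-- The edges in `P` force the common vertex value to be `0`, which kills the amplitudes on all
other edges. What is left is the kernel of one non-zero linear form on the amplitudes in `P`. -/
theorem finrank_matchSpace_of_zero (hr : ∀ j, 0 < r j) (hu : u = 0) (hu' : u' ≠ 0) (hv : v ≠ 0)
    (hP : ∃ j, P j) :
    Module.finrank ℂ
      (matchSpace r (fun j => if P j then u else u') (fun j => if P j then v else v'))
      = Fintype.card {j // P j} - 1 := by
  have hrC : ∀ j, (r j : ℂ) ≠ 0 := fun j => Complex.ofReal_ne_zero.2 (hr j).ne'
  set ℓ : ({j // P j} → ℂ) →ₗ[ℂ] ℂ :=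
    Fintype.linearCombination ℂ (fun j : {j // P j} => ((1 / r j : ℝ) : ℂ)) with hℓ
  have hℓ0 : ℓ ≠ 0 := by
    classical
    obtain ⟨i, hi⟩ := hP
    intro h0
    have := LinearMap.congr_fun h0 (Pi.single ⟨i, hi⟩ 1)
    rw [hℓ, Fintype.linearCombination_apply_single] at this
    simp [(hr i).ne'] at this
  have hker : Module.finrank ℂ (LinearMap.ker ℓ) = Fintype.card {j // P j} - 1 := by
    have := Module.Dual.finrank_ker_add_one_of_ne_zero hℓ0
    rw [Module.finrank_fintype_fun_eq_card] at this
    omega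
  set E : ({j // P j} → ℂ) →ₗ[ℂ] (ι → ℂ) :=
    Function.ExtendByZero.linearMap ℂ (Subtype.val : {j // P j} → ι)
  have hE1 : ∀ (d : {j // P j} → ℂ) (j : {j // P j}), E d j = d j := fun d j =>
    Subtype.val_injective.extend_apply d 0 j
  have hE0 : ∀ (d : {j // P j} → ℂ) (j : ι), ¬ P j → E d j = 0 := fun d j hj =>
    Function.extend_apply' (f := Subtype.val) d (0 : ι → ℂ) j (by rintro ⟨k, rfl⟩; exact hj k.2)
  have hEinj : Function.Injective E := fun d d' h => funext fun j => by
    rw [← hE1 d j, ← hE1 d' j, h]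
  have hsum : ∀ c : ι → ℂ, (∀ j, ¬ P j → c j = 0) →
      ∑ j, ((1 / r j : ℝ) : ℂ) * (c j * ((if P j then v else v' : ℝ) : ℂ))
        = v * ℓ (fun j => c j) := by
    intro c hc
    rw [hℓ, Fintype.linearCombination_apply, Finset.mul_sum,
      ← Finset.sum_filter_add_sum_filter_not Finset.univ P,
      Finset.sum_eq_zero (s := Finset.univ.filter fun j => ¬ P j), add_zero,
      Finset.sum_subtype (Finset.univ.filter P) (p := P) (by simp)]
    · refine Finset.sum_congr rfl fun j _ => ?_
      rw [if_pos j.2, smul_eq_mul]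
      ring
    · intro j hj
      rw [hc j (Finset.mem_filter.1 hj).2]
      simp
  have hmap : matchSpace r (fun j => if P j then u else u') (fun j => if P j then v else v')
      = (LinearMap.ker ℓ).map E := by
    ext c
    constructor
    · rintro ⟨h1, h2⟩
      obtain ⟨i, hi⟩ := hP
      have hc : ∀ j, ¬ P j → c j = 0 := fun j hj => by
        have := h1 j i
        simpa [hi, hj, hu, hu', (hr j).ne'] using this
      refine ⟨fun j => c j, ?_, ?_⟩
      · rw [hsum c hc] at h2
        exact (mul_eq_zero.1 h2).resolve_left (Complex.ofReal_ne_zero.2 hv)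
      · funext j
        by_cases hj : P j
        · exact hE1 _ ⟨j, hj⟩
        · rw [hE0 _ j hj, hc j hj]
    · rintro ⟨d, hd, rfl⟩
      have h3 : ∀ j, (r j : ℂ) * (E d j * ((if P j then u else u' : ℝ) : ℂ)) = 0 := fun j => by
        by_cases hj : P j
        · simp [hj, hu]
        · simp [hE0 d j hj]
      refine ⟨fun i j => by rw [h3 i, h3 j], ?_⟩
      rw [hsum _ (hE0 d)]
      have : (fun j : {j // P j} => E d j) = d := funext (hE1 d)
      rw [this, LinearMap.mem_ker.1 hd, mul_zero]
  rw [hmap, ← hker]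
  exact (Submodule.equivMapOfInjective E hEinj _).finrank_eq.symm

end Matching

/-! ### Eigenvectors of the Hessian operators -/

section Hessian

variable {N : ℕ} {p : ℝ} {α : Fin N → ℝ} {c : ℝ} {V : Fin N → (ℝ →ᵇ ℝ)} {z : ℂ}

theorem coeFn_mulEdge (g : ℝ →ᵇ ℝ) (u : L2Edge) :
    mulEdge g u =ᵐ[volume.restrict (Ioi (0 : ℝ))] fun x => (g x : ℂ) * u x :=
  (memLp_mul g u).coeFn_toLp

theorem mem_eigenspace_hessian_iff (Ψ : (hessian p α c V).domain) :
    Ψ ∈ eigenspace (hessian p α c V) z ↔ ∀ j, ∀ᵐ x ∂(volume.restrict (Ioi (0 : ℝ))),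
      weakDeriv (weakDeriv (Ψ.1 j)) x = ((1 - z) - c * V j x) * Ψ.1 j x := by
  have h1 : Ψ ∈ eigenspace (hessian p α c V) z ↔ ∀ j,
      -weakDeriv (weakDeriv (Ψ.1 j)) + (Ψ.1 j - (c : ℂ) • mulEdge (V j) (Ψ.1 j))
        - z • Ψ.1 j = 0 := by
    rw [eigenspace, LinearMap.mem_ker]
    constructor
    · intro h j
      exact congrArg (fun X : L2Graph N => X j) h
    · intro h
      ext1 j
      exact h j
  rw [h1]
  refine forall_congr' fun j => ?_
  set u := Ψ.1 j
  set w := weakDeriv (weakDeriv u)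
  have h2 : (-w + (u - (c : ℂ) • mulEdge (V j) u) - z • u = 0) ↔
      w = (u - (c : ℂ) • mulEdge (V j) u) - z • u := by
    constructor
    · intro h
      rw [← sub_eq_zero, ← neg_eq_zero, ← h]
      abel
    · intro h
      rw [h]
      abel
  rw [h2, Lp.ext_iff]
  have h3 : ((u - (c : ℂ) • mulEdge (V j) u) - z • u : L2Edge)
      =ᵐ[volume.restrict (Ioi (0 : ℝ))] fun x => ((1 - z) - c * V j x) * u x := by
    filter_upwards [Lp.coeFn_sub (u - (c : ℂ) • mulEdge (V j) u) (z • u),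
      Lp.coeFn_sub u ((c : ℂ) • mulEdge (V j) u), Lp.coeFn_smul (c : ℂ) (mulEdge (V j) u),
      Lp.coeFn_smul z u, coeFn_mulEdge (V j) u] with x e1 e2 e3 e4 e5
    rw [e1, Pi.sub_apply, e2, Pi.sub_apply, e3, e4, Pi.smul_apply, Pi.smul_apply, e5, smul_eq_mul,
      smul_eq_mul]
    ring
  exact ⟨fun h => h.trans h3, fun h => Filter.EventuallyEq.trans h h3.symm⟩

/-- The eigenvalues of the Hessian operators are real. -/
theorem im_eq_zero_of_mem_pointSpectrum (hα : ∀ j, 0 < α j)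
    (hz : z ∈ pointSpectrum (hessian p α c V)) : z.im = 0 := by
  by_contra him
  refine hz ((Submodule.eq_bot_iff _).2 fun Ψ hΨ => ?_)
  have hdom : Ψ.1 ∈ H2Graph p α := Ψ.2
  have hQ : ∀ j, Continuous fun x => (1 - z) - (c : ℂ) * V j x := fun j => by
    have := (V j).continuous
    fun_prop
  choose f f' hf h0 h0' hae using fun j =>
    exists_isDecayingSolution (hQ j) (hdom.1 j) ((mem_eigenspace_hessian_iff Ψ).1 hΨ j)
  -- Green's formula: the imaginary part of `f̄ f''` is `-(Im z) |f|²`, because the potential is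
  -- real. With this normalization `G' = ∑ |f j|²`; since `G` vanishes at the vertex and at
  -- infinity, so does every `f j`.
  set G : ℝ → ℝ := fun x => ∑ j, ((starRingEnd ℂ) (f j x) * f' j x).im * (-1 / z.im) with hG
  have hd : ∀ x, 0 < x → HasDerivAt G (∑ j, ‖f j x‖ ^ 2) x := by
    intro x hx
    refine HasDerivAt.fun_sum fun j _ => ?_
    have h1 := ((hf j).hasDerivAt x hx).star.mul ((hf j).hasDerivAt' x hx)
    have h2 := (Complex.imCLM.hasFDerivAt.comp_hasDerivAt x h1).mul_const (-1 / z.im)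
    refine h2.congr_deriv ?_
    have e : ‖f j x‖ ^ 2 = (f j x).re ^ 2 + (f j x).im ^ 2 := by
      rw [← Complex.normSq_eq_norm_sq, Complex.normSq_apply]; ring
    rw [e]
    field_simp
    simp
    ring
  have hcont : ContinuousOn G (Ici 0) := by
    refine continuousOn_finsetSum _ fun j _ => ContinuousOn.mul ?_ continuousOn_const
    exact Complex.continuous_im.comp_continuousOn
      ((Complex.continuous_conj.comp_continuousOn (hf j).continuousOn).mul (hf j).continuousOn')
  have hmono : MonotoneOn G (Ici 0) := by
    refine monotoneOn_of_deriv_nonneg (convex_Ici 0) hcont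
      (fun x hx => (hd x (by simpa using hx)).differentiableAt.differentiableWithinAt) fun x hx => ?_
    rw [interior_Ici] at hx
    rw [(hd x hx).deriv]
    positivity
  have hlim : Filter.Tendsto G Filter.atTop (nhds 0) := by
    have : Filter.Tendsto G Filter.atTop
        (nhds (∑ j : Fin N, ((starRingEnd ℂ) (0 : ℂ) * 0).im * (-1 / z.im))) := by
      refine tendsto_finsetSum _ fun j _ => Filter.Tendsto.mul_const _ ?_
      exact (Complex.continuous_im.tendsto _).comp
        (((Complex.continuous_conj.tendsto _).comp (hf j).tendsto).mul (hf j).tendsto')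
    simpa using this
  have hG0 : G 0 = 0 := by
    simp only [hG]
    rw [← Finset.sum_mul]
    have : ∑ j, (starRingEnd ℂ) (f j 0) * f' j 0 = 0 := by
      rcases isEmpty_or_nonempty (Fin N) with h | ⟨⟨i⟩⟩
      · simp
      have hr : ∀ j, ((α j ^ (1 / p) : ℝ) : ℂ) ≠ 0 := fun j =>
        Complex.ofReal_ne_zero.2 (Real.rpow_pos_of_pos (hα j) _).ne'
      -- Continuity makes the conjugated weighted value the same on all edges, so it factors out and
      -- leaves the Kirchhoff sum.
      have h1 : ∀ j, (starRingEnd ℂ) (f j 0) * f' j 0 =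
          (starRingEnd ℂ) (((α i ^ (1 / p) : ℝ) : ℂ) * f i 0) *
            (((1 / α j ^ (1 / p) : ℝ) : ℂ) * trace (weakDeriv (Ψ.1 j))) := by
        intro j
        rw [h0 i, hdom.2.1.2 i j, ← h0 j, ← h0' j, map_mul, Complex.conj_ofReal]
        have := hr j
        push_cast at this ⊢
        field_simp
      rw [Finset.sum_congr rfl fun j _ => h1 j, ← Finset.mul_sum, hdom.2.2, mul_zero]
    rw [← Complex.im_sum, this]
    simp
  have hzero : ∀ x, 0 ≤ x → G x = 0 := fun x hx => by
    refine le_antisymm (ge_of_tendsto hlim ?_) ?_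
    · filter_upwards [Filter.eventually_ge_atTop x] with y hy using hmono hx (hx.trans hy) hy
    · rw [← hG0]; exact hmono self_mem_Ici hx hx
  have hf0 : ∀ x, 0 < x → ∀ j, f j x = 0 := by
    intro x hx j
    have h2 : HasDerivAt G 0 x := by
      refine (hasDerivAt_const x (0 : ℝ)).congr_of_eventuallyEq ?_
      filter_upwards [Ioi_mem_nhds hx] with y hy using hzero y (le_of_lt hy)
    have h3 := (hd x hx).unique h2
    have h4 := (Finset.sum_eq_zero_iff_of_nonneg fun j _ => sq_nonneg ‖f j x‖).1 h3 j
      (Finset.mem_univ j)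
    simpa using h4
  refine Subtype.ext ?_
  ext1 j
  refine Lp.ext ?_
  filter_upwards [hae j, ae_restrict_mem measurableSet_Ioi,
    Lp.coeFn_zero (E := ℂ) (p := 2) (μ := volume.restrict (Ioi (0 : ℝ)))] with x h1 h2 h3
  rw [h1, hf0 x h2 j]
  exact h3.symm

/-- The state with amplitude `cⱼ` on the `j`-th edge. -/
def glue (s : ℝ) {κ : ℝ} (hκ : 0 < κ) (hp : 0 < p) (τ : Fin N → ℝ) :
    (Fin N → ℂ) →ₗ[ℂ] L2Graph N where
  toFun d := WithLp.toLp 2 fun j => d j • edgeState s hκ hp (τ j)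
  map_add' d d' := by
    ext1 j
    exact add_smul _ _ _
  map_smul' z d := by
    ext1 j
    exact mul_smul _ _ _

theorem glue_apply (s : ℝ) {κ : ℝ} (hκ : 0 < κ) (hp : 0 < p) (τ : Fin N → ℝ) (d : Fin N → ℂ)
    (j : Fin N) : glue s hκ hp τ d j = d j • edgeState s hκ hp (τ j) := rfl

theorem glue_injective (s : ℝ) {κ : ℝ} (hκ : 0 < κ) (hp : 0 < p) (τ : Fin N → ℝ) :
    Function.Injective (glue s hκ hp τ) := fun d d' h => funext fun j => by
  have h1 : d j • edgeState s hκ hp (τ j) = d' j • edgeState s hκ hp (τ j) := by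
    rw [← glue_apply, ← glue_apply, h]
  exact smul_left_injective ℂ (edgeState_ne_zero s hκ hp (τ j)) h1

/-- Below the essential spectrum, the eigenspaces are described by the vertex conditions. -/
theorem rank_eigenspace_hessian (s : ℝ) {κ : ℝ} (hκ : 0 < κ) (hp : 0 < p) (τ : Fin N → ℝ)
    (hc : c = p ^ 2 * (s * (s + 1)))
    (hV : ∀ j x, V j x = 1 - Real.tanh (p * (x + τ j)) ^ 2)
    (hz : z = ((1 - p ^ 2 * κ ^ 2 : ℝ) : ℂ)) :
    Module.rank ℂ (eigenspace (hessian p α c V) z) =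
      Module.finrank ℂ (matchSpace (fun j => α j ^ (1 / p)) (fun j => jost s κ (p * τ j))
        (fun j => p * jostDeriv s κ (p * τ j))) := by
  set S := matchSpace (fun j => α j ^ (1 / p)) (fun j => jost s κ (p * τ j))
        (fun j => p * jostDeriv s κ (p * τ j))
  have hcoeff : ∀ j x, ((1 - z) - c * V j x) = edgeCoeff s κ p (τ j) x := fun j x => by
    rw [hV, hz, hc, edgeCoeff]
    push_cast
    ring
  -- The eigenspace and the space of amplitudes are compared through their injective images in
  -- `L2Graph N`.
  have hmap : (eigenspace (hessian p α c V) z).map (hessian p α c V).domain.subtype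
      = S.map (glue s hκ hp τ) := by
    ext Ψ
    constructor
    · rintro ⟨Ψ, hΨ, rfl⟩
      have hdom : Ψ.1 ∈ H2Graph p α := Ψ.2
      rw [SetLike.mem_coe, mem_eigenspace_hessian_iff] at hΨ
      simp only [hcoeff] at hΨ
      choose d hd using fun j => exists_eq_smul_edgeState s hκ hp (τ j) (hdom.1 j) (hΨ j)
      have hval : ∀ j, trace (Ψ.1 j) = d j * ((jost s κ (p * τ j) : ℝ) : ℂ) := fun j => by
        rw [hd j, trace_smul _ (edgeState_mem s hκ hp (τ j)).1, trace_edgeState]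
      have hder : ∀ j, trace (weakDeriv (Ψ.1 j)) =
          d j * ((p * jostDeriv s κ (p * τ j) : ℝ) : ℂ) := fun j => by
        rw [hd j, weakDeriv_smul _ (edgeState_mem s hκ hp (τ j)).1,
          trace_smul _ (edgeState_mem s hκ hp (τ j)).2, trace_weakDeriv_edgeState]
      refine ⟨d, ⟨fun i j => ?_, ?_⟩, ?_⟩
      · rw [← hval, ← hval]
        exact hdom.2.1.2 i j
      · simp only [← hder]
        exact hdom.2.2
      · ext1 j
        exact (hd j).symm
    · rintro ⟨d, ⟨h1, h2⟩, rfl⟩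
      have hmem : ∀ j, glue s hκ hp τ d j ∈ H2Edge := fun j =>
        H2Edge.smul_mem _ (edgeState_mem s hκ hp (τ j))
      have hval : ∀ j, trace (glue s hκ hp τ d j) = d j * ((jost s κ (p * τ j) : ℝ) : ℂ) :=
        fun j => by
          rw [glue_apply, trace_smul _ (edgeState_mem s hκ hp (τ j)).1, trace_edgeState]
      have hder : ∀ j, trace (weakDeriv (glue s hκ hp τ d j)) =
          d j * ((p * jostDeriv s κ (p * τ j) : ℝ) : ℂ) := fun j => by
        rw [glue_apply, weakDeriv_smul _ (edgeState_mem s hκ hp (τ j)).1,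
          trace_smul _ (edgeState_mem s hκ hp (τ j)).2, trace_weakDeriv_edgeState]
      have hdom : glue s hκ hp τ d ∈ H2Graph p α := by
        refine ⟨hmem, ⟨fun j => (hmem j).1, fun i j => ?_⟩, ?_⟩
        · rw [hval, hval]; exact h1 i j
        · simp only [hder]; exact h2
      refine ⟨⟨glue s hκ hp τ d, hdom⟩, ?_, rfl⟩
      rw [SetLike.mem_coe, mem_eigenspace_hessian_iff]
      intro j
      simp only [hcoeff]
      change ∀ᵐ x ∂_, weakDeriv (weakDeriv (d j • edgeState s hκ hp (τ j))) x
        = edgeCoeff s κ p (τ j) x * (d j • edgeState s hκ hp (τ j)) x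
      rw [weakDeriv_smul _ (edgeState_mem s hκ hp (τ j)).1,
        weakDeriv_smul _ (edgeState_mem s hκ hp (τ j)).2]
      filter_upwards [weakDeriv_weakDeriv_edgeState s hκ hp (τ j),
        Lp.coeFn_smul (d j) (edgeState s hκ hp (τ j)),
        Lp.coeFn_smul (d j) (weakDeriv (weakDeriv (edgeState s hκ hp (τ j))))] with x e1 e2 e3
      rw [e2, e3, Pi.smul_apply, Pi.smul_apply, e1, smul_eq_mul, smul_eq_mul]
      ring
  rw [Module.finrank_eq_rank,
    (Submodule.equivMapOfInjective _ (glue_injective s hκ hp τ) S).rank_eq, ← hmap]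
  exact (Submodule.equivMapOfInjective _ (Submodule.subtype_injective _) _).rank_eq

end Hessian

/-! ### The spectrum of the Hessian operators -/

theorem notMem_pointSpectrum_of_rank_eq_zero {E : Type*} [AddCommGroup E] [Module ℂ E]
    {T : E →ₗ.[ℂ] E} {z : ℂ} (h : HasMultiplicity T z 0) : z ∉ pointSpectrum T := by
  rw [HasMultiplicity, Nat.cast_zero, Submodule.rank_eq_zero] at h
  exact fun hz => hz h

section Balanced

variable {N : ℕ} {p b s : ℝ} {α : Fin N → ℝ} {c : ℝ} {V : Fin N → (ℝ →ᵇ ℝ)} {P : Fin N → Prop}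
  [DecidablePred P]

theorem hasMultiplicity_hessian {κ : ℝ} (hκ : 0 < κ) (hp : 0 < p)
    (hc : c = p ^ 2 * (s * (s + 1)))
    (hV : ∀ j x, V j x = 1 - Real.tanh (p * (x + if P j then -b else b)) ^ 2) {m : ℕ}
    (hm : Module.finrank ℂ (matchSpace (fun j => α j ^ (1 / p))
      (fun j => if P j then jost s κ (-(p * b)) else jost s κ (p * b))
      (fun j => if P j then p * jostDeriv s κ (-(p * b)) else p * jostDeriv s κ (p * b))) = m) :
    HasMultiplicity (hessian p α c V) ((1 - p ^ 2 * κ ^ 2 : ℝ) : ℂ) m := by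
  rw [HasMultiplicity, rank_eigenspace_hessian s hκ hp (fun j => if P j then -b else b) hc hV rfl,
    ← hm]
  have e1 : (fun j => jost s κ (p * if P j then -b else b))
      = fun j => if P j then jost s κ (-(p * b)) else jost s κ (p * b) := by
    funext j; split_ifs <;> simp
  have e2 : (fun j => p * jostDeriv s κ (p * if P j then -b else b))
      = fun j => if P j then p * jostDeriv s κ (-(p * b)) else p * jostDeriv s κ (p * b) := by
    funext j; split_ifs <;> simp
  rw [e1, e2]

/-- The quantity that decides between `matchSpace_eq_bot` and `finrank_matchSpace_eq_one` does not
depend on the shift `b`. -/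
theorem vertex_wronskian {κ : ℝ} (hκ : 0 < κ) (s p b : ℝ) :
    jost s κ (p * b) * (p * jostDeriv s κ (-(p * b))) + p * jostDeriv s κ (p * b) *
      jost s κ (-(p * b)) = 2 * p * (jost s κ 0 * jostDeriv s κ 0) := by
  linear_combination p * jost_wronskian_const s hκ (p * b)

/-- Every number below `1 - p² η²` has the form `1 - p² κ²` with `κ > η`. -/
theorem exists_decay_rate (hp : 0 < p) {η r : ℝ} (hr : r < 1 - p ^ 2 * η ^ 2) :
    ∃ κ, η < κ ∧ r = 1 - p ^ 2 * κ ^ 2 := by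
  refine ⟨Real.sqrt (1 - r) / p, ?_, ?_⟩
  · rw [lt_div_iff₀ hp]
    refine Real.lt_sqrt_of_sq_lt ?_
    nlinarith
  · have h : 0 ≤ 1 - r := by nlinarith [mul_nonneg (sq_nonneg p) (sq_nonneg η)]
    rw [div_pow, Real.sq_sqrt h]
    field_simp
    ring

theorem exists_ofReal_eq {z : ℂ} (hα : ∀ j, 0 < α j)
    (hz : z ∈ pointSpectrum (hessian p α c V)) : ∃ r : ℝ, z = r :=
  ⟨z.re, (Complex.ext (by simp) (by simp [im_eq_zero_of_mem_pointSpectrum hα hz]))⟩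

/-- The normalization `p s = 1` places the ground state `κ = s` at the eigenvalue `0`. -/
theorem spectrum_ground (hp : 0 < p) (hα : ∀ j, 0 < α j) (hs : p * s = 1)
    (hc : c = p ^ 2 * (s * (s + 1)))
    (hV : ∀ j x, V j x = 1 - Real.tanh (p * (x + if P j then -b else b)) ^ 2)
    (hbal : ∑ j with P j, 1 / (α j ^ (1 / p)) ^ 2 = ∑ j with ¬ P j, 1 / (α j ^ (1 / p)) ^ 2)
    (hP : ∃ j, P j) :
    HasMultiplicity (hessian p α c V) 0 1 ∧
      ∃ δ : ℝ, 0 < δ ∧ ∀ z ∈ pointSpectrum (hessian p α c V),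
        z = 0 ∨ ∃ r : ℝ, δ ≤ r ∧ z = r := by
  have hs0 : 0 < s := pos_of_mul_pos_right (by rw [hs]; exact one_pos) hp.le
  have hr : ∀ j, 0 < α j ^ (1 / p) := fun j => Real.rpow_pos_of_pos (hα j) _
  constructor
  · have h := hasMultiplicity_hessian (b := b) (P := P) (α := α) (V := V) hs0 hp hc hV
      (finrank_matchSpace_eq_one hr (jost_pos hs0 le_rfl _).ne' (jost_pos hs0 le_rfl _).ne'
        (by rw [vertex_wronskian hs0, jostDeriv_self_zero]; ring) hbal hP)
    have e : 1 - p ^ 2 * s ^ 2 = 0 := by rw [← mul_pow, hs]; norm_num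
    rwa [e, Complex.ofReal_zero] at h
  · obtain ⟨η, h0, h1, h2⟩ := exists_gap_ground hs0 (p * b)
    -- Any eigenvalue below this `δ` has `κ > s - η`, the range covered by `exists_gap_ground`.
    refine ⟨1 - p ^ 2 * (s - η) ^ 2, ?_, fun z hz => ?_⟩
    · rw [← mul_pow]
      have h3 : p * (s - η) < 1 := by nlinarith
      have h4 : 0 < p * (s - η) := mul_pos hp (by linarith)
      nlinarith
    obtain ⟨r, rfl⟩ := exists_ofReal_eq hα hz
    by_cases hr' : 1 - p ^ 2 * (s - η) ^ 2 ≤ r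
    · exact Or.inr ⟨r, hr', rfl⟩
    obtain ⟨κ, hκ, rfl⟩ := exists_decay_rate hp (not_le.1 hr')
    have hκ0 : 0 < κ := by linarith
    by_cases hne : κ = s
    · left
      rw [hne, ← mul_pow, hs]
      norm_num
    · obtain ⟨q1, q2, q3, q4⟩ := h2 κ hκ hne
      refine absurd hz (notMem_pointSpectrum_of_rank_eq_zero
        (hasMultiplicity_hessian (b := b) (P := P) hκ0 hp hc hV ?_))
      rw [matchSpace_eq_bot hr q2 q1 (by
        rw [vertex_wronskian hκ0]
        exact mul_ne_zero (by positivity) (mul_ne_zero q3 q4)) hbal hP, finrank_bot]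

/-- The normalization `p (s - 1) = 1` places the odd state `κ = s - 1` at `0`, so the rates `s > κ₁
> s - 1` give `lam0 < lam1 < 0`. -/
theorem spectrum_excited (hp : 0 < p) (hb : 0 < b) (hα : ∀ j, 0 < α j) (hs : p * (s - 1) = 1)
    (hc : c = p ^ 2 * (s * (s + 1)))
    (hV : ∀ j x, V j x = 1 - Real.tanh (p * (x + if P j then -b else b)) ^ 2)
    (hbal : ∑ j with P j, 1 / (α j ^ (1 / p)) ^ 2 = ∑ j with ¬ P j, 1 / (α j ^ (1 / p)) ^ 2)
    (hP : ∃ j, P j) :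
    ∃ lam0 lam1 : ℝ, lam0 < lam1 ∧ lam1 < 0 ∧
      HasMultiplicity (hessian p α c V) lam0 1 ∧
      HasMultiplicity (hessian p α c V) lam1 (Fintype.card {j // P j} - 1) ∧
      HasMultiplicity (hessian p α c V) 0 1 ∧
      ∃ δ : ℝ, 0 < δ ∧ ∀ z ∈ pointSpectrum (hessian p α c V),
        z = lam0 ∨ z = lam1 ∨ z = 0 ∨ ∃ r : ℝ, δ ≤ r ∧ z = r := by
  have hs1 : 0 < s - 1 := pos_of_mul_pos_right (by rw [hs]; exact one_pos) hp.le
  have hs0 : 0 < s := by linarith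
  have hr : ∀ j, 0 < α j ^ (1 / p) := fun j => Real.rpow_pos_of_pos (hα j) _
  obtain ⟨κ₁, η, k1, k2, e1, e2, hk, h⟩ := exists_gap_excited (by linarith : 1 < s) (mul_pos hp hb)
  have hκ₁ : 0 < κ₁ := by linarith
  have hzero : 1 - p ^ 2 * (s - 1) ^ 2 = 0 := by rw [← mul_pow, hs]; norm_num
  have hp2 : 0 < p ^ 2 := by positivity
  refine ⟨1 - p ^ 2 * s ^ 2, 1 - p ^ 2 * κ₁ ^ 2, ?_, ?_, ?_, ?_, ?_,
    1 - p ^ 2 * (s - 1 - η) ^ 2, ?_, fun z hz => ?_⟩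
  · have : κ₁ ^ 2 < s ^ 2 := by nlinarith
    nlinarith
  · have : (s - 1) ^ 2 < κ₁ ^ 2 := by nlinarith
    nlinarith
  · exact hasMultiplicity_hessian (b := b) (P := P) hs0 hp hc hV
      (finrank_matchSpace_eq_one hr (jost_pos hs0 le_rfl _).ne' (jost_pos hs0 le_rfl _).ne'
        (by rw [vertex_wronskian hs0, jostDeriv_self_zero]; ring) hbal hP)
  · obtain ⟨q1, -, q3, q4⟩ := h κ₁ (by linarith)
    refine hasMultiplicity_hessian (b := b) (P := P) hκ₁ hp hc hV
      (finrank_matchSpace_of_zero hr hk q1 ?_ hP)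
    -- The rate `κ₁` differs from `s` and `s - 1`, so the vertex Wronskian is non-zero; the value
    -- and the derivative at `-(p * b)` cannot both vanish.
    intro hv
    have hW := vertex_wronskian hκ₁ s p b
    rw [hv, hk, mul_zero, mul_zero, add_zero] at hW
    have q5 : jost s κ₁ 0 ≠ 0 := fun h0 => by linarith [q3 h0]
    have q6 : jostDeriv s κ₁ 0 ≠ 0 := fun h0 => by linarith [q4 h0]
    exact mul_ne_zero (by positivity) (mul_ne_zero q5 q6) hW.symm
  · obtain ⟨q1, q2, -, -⟩ := h (s - 1) (by linarith)
    have h' := hasMultiplicity_hessian (b := b) (P := P) (α := α) (V := V) hs1 hp hc hV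
      (finrank_matchSpace_eq_one hr (fun h0 => by linarith [q2 h0]) q1
        (by rw [vertex_wronskian hs1, jost_sub_one (by linarith), Real.tanh_zero]; ring) hbal hP)
    rwa [hzero, Complex.ofReal_zero] at h'
  · have : (s - 1 - η) ^ 2 < (s - 1) ^ 2 := by nlinarith
    nlinarith
  · obtain ⟨r, rfl⟩ := exists_ofReal_eq hα hz
    by_cases hr' : 1 - p ^ 2 * (s - 1 - η) ^ 2 ≤ r
    · exact Or.inr (Or.inr (Or.inr ⟨r, hr', rfl⟩))
    obtain ⟨κ, hκ, rfl⟩ := exists_decay_rate hp (not_le.1 hr')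
    have hκ0 : 0 < κ := by linarith
    obtain ⟨q1, q2, q3, q4⟩ := h κ hκ
    by_cases h2 : jost s κ (-(p * b)) = 0
    · rw [q2 h2]; exact Or.inr (Or.inl rfl)
    by_cases h3 : jost s κ 0 = 0
    · rw [q3 h3, hzero]; exact Or.inr (Or.inr (Or.inl Complex.ofReal_zero))
    by_cases h4 : jostDeriv s κ 0 = 0
    · rw [q4 h4]; exact Or.inl rfl
    refine absurd hz (notMem_pointSpectrum_of_rank_eq_zero
      (hasMultiplicity_hessian (b := b) (P := P) hκ0 hp hc hV ?_))
    rw [matchSpace_eq_bot hr h2 q1 (by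
      rw [vertex_wronskian hκ0]
      exact mul_ne_zero (by positivity) (mul_ne_zero h3 h4)) hbal hP, finrank_bot]

end Balanced

/-! ### The potential of the shifted state and the sizes of the two groups of edges -/

theorem soliton_rpow {p : ℝ} (hp : 0 < p) (x : ℝ) :
    soliton p x ^ (2 * p) = 1 - Real.tanh (p * x) ^ 2 := by
  rw [soliton, ← Real.rpow_mul (one_div_pos.2 (Real.cosh_pos _)).le, ← one_div_cosh_sq,
    show 1 / p * (2 * p) = ((2 : ℕ) : ℝ) by field_simp; norm_num, Real.rpow_natCast]

/-- The amplitude `α^(-1/p)` raised to the power `2p` is `α^(-2)`, which cancels the factor `α²`;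
the potential sees only the shift. -/
theorem shiftedPotential_apply {N : ℕ} (K : ℕ) {p : ℝ} (hp : 0 < p) {α : Fin N → ℝ}
    (hα : ∀ j, 0 < α j) (a : ℝ) (j : Fin N) (x : ℝ) :
    shiftedPotential K hp hα a j x
      = 1 - Real.tanh (p * (x + if (j : ℕ) < K then a else -a)) ^ 2 := by
  have h1 : shiftedPotential K hp hα a j x = α j ^ 2 * shiftedState K p α a j x ^ (2 * p) := rfl
  have h2 : shiftedState K p α a j x
      = α j ^ (-1 / p) * soliton p (x + if (j : ℕ) < K then a else -a) := by
    rw [shiftedState]; split_ifs <;> rfl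
  rw [h1, h2, Real.mul_rpow (Real.rpow_pos_of_pos (hα j) _).le (soliton_pos _ _).le,
    soliton_rpow hp, ← Real.rpow_mul (hα j).le, ← mul_assoc,
    show -1 / p * (2 * p) = -((2 : ℕ) : ℝ) by field_simp; norm_num, Real.rpow_neg (hα j).le,
    Real.rpow_natCast, mul_inv_cancel₀ (pow_pos (hα j) 2).ne', one_mul]

theorem rpow_one_div_sq {p x : ℝ} (hx : 0 < x) : (x ^ (1 / p)) ^ 2 = x ^ (2 / p) := by
  rw [← Real.rpow_natCast, ← Real.rpow_mul hx.le]
  congr 1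
  push_cast
  ring

theorem card_subtype_lt {N K : ℕ} (h : K < N) : Fintype.card {j : Fin N // (j : ℕ) < K} = K := by
  rw [Fintype.card_subtype, Fin.card_filter_val_lt, min_eq_right h.le]

theorem card_subtype_not_lt {N K : ℕ} (h : K < N) :
    Fintype.card {j : Fin N // ¬ (j : ℕ) < K} = N - K := by
  rw [Fintype.card_subtype_compl, card_subtype_lt h, Fintype.card_fin]

end StarGraph

end

theorem theorem4p1 (N K : ℕ) (hK : 0 < K) (hKN : K < N) (p : ℝ) (hp : 0 < p)
    (α : Fin N → ℝ) (hα : ∀ j, 0 < α j)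
    (hconstr : ∑ j : Fin N with j.val < K, 1 / α j ^ (2 / p) =
      ∑ j : Fin N with K ≤ j.val, 1 / α j ^ (2 / p))
    (a : ℝ) (ha : a ≠ 0) :
    ((∀ z ∈ StarGraph.pointSpectrum (StarGraph.Lminus K hp hα a), ∃ r : ℝ, 0 ≤ r ∧ z = r) ∧
      StarGraph.HasMultiplicity (StarGraph.Lminus K hp hα a) 0 1 ∧
      ∃ δ : ℝ, 0 < δ ∧ ∀ z ∈ StarGraph.pointSpectrum (StarGraph.Lminus K hp hα a),
        z = 0 ∨ ∃ r : ℝ, δ ≤ r ∧ z = r) ∧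
    (∃ lam0 lam1 : ℝ, lam0 < lam1 ∧ lam1 < 0 ∧
      StarGraph.HasMultiplicity (StarGraph.Lplus K hp hα a) lam0 1 ∧
      (a < 0 → StarGraph.HasMultiplicity (StarGraph.Lplus K hp hα a) lam1 (K - 1)) ∧
      (0 < a → StarGraph.HasMultiplicity (StarGraph.Lplus K hp hα a) lam1 (N - K - 1)) ∧
      StarGraph.HasMultiplicity (StarGraph.Lplus K hp hα a) 0 1 ∧
      ∃ δ : ℝ, 0 < δ ∧ ∀ z ∈ StarGraph.pointSpectrum (StarGraph.Lplus K hp hα a),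
        z = lam0 ∨ z = lam1 ∨ z = 0 ∨ ∃ r : ℝ, δ ≤ r ∧ z = r) := by
  have hbal : ∑ j : Fin N with j.val < K, 1 / (α j ^ (1 / p)) ^ 2
      = ∑ j : Fin N with ¬ j.val < K, 1 / (α j ^ (1 / p)) ^ 2 := by
    simp only [StarGraph.rpow_one_div_sq (hα _), not_lt]
    exact hconstr
  -- These identities read off `s = 1/p` for `L₋` and `s = 1 + 1/p` for `L₊` from `c = p² s (s +
  -- 1)`.
  have hcm : p + 1 = p ^ 2 * (1 / p * (1 / p + 1)) := by field_simp; ring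
  have hcp : (2 * p + 1) * (p + 1) = p ^ 2 * ((1 + 1 / p) * (1 + 1 / p + 1)) := by
    field_simp; ring
  have hsm : p * (1 / p) = 1 := by field_simp
  have hsp : p * (1 + 1 / p - 1) = 1 := by field_simp; ring
  have hV := StarGraph.shiftedPotential_apply K hp hα a
  have hground : StarGraph.HasMultiplicity (StarGraph.Lminus K hp hα a) 0 1 ∧
      ∃ δ : ℝ, 0 < δ ∧ ∀ z ∈ StarGraph.pointSpectrum (StarGraph.Lminus K hp hα a),
        z = 0 ∨ ∃ r : ℝ, δ ≤ r ∧ z = r := by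
    -- The sign of the shift is irrelevant here, because the decaying solutions involved have no
    -- zero at either vertex position.
    refine StarGraph.spectrum_ground (b := -a) (P := fun j : Fin N => j.val < K) hp hα hsm hcm
      (fun j x => ?_) hbal ⟨⟨0, hK.trans hKN⟩, hK⟩
    rw [hV, neg_neg]
  refine ⟨⟨fun z hz => ?_, hground⟩, ?_⟩
  · obtain ⟨δ, h0, h1⟩ := hground.2
    rcases h1 z hz with rfl | ⟨r, hr, rfl⟩
    · exact ⟨0, le_rfl, Complex.ofReal_zero.symm⟩
    · exact ⟨r, h0.le.trans hr, rfl⟩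
  · rcases ha.lt_or_gt with ha | ha
    · obtain ⟨l0, l1, h1, h2, h3, h4, h5⟩ :=
        StarGraph.spectrum_excited (b := -a) (P := fun j : Fin N => j.val < K)
          hp (neg_pos.2 ha) hα hsp hcp (fun j x => by rw [hV, neg_neg]) hbal
          ⟨⟨0, hK.trans hKN⟩, hK⟩
      rw [StarGraph.card_subtype_lt hKN] at h4
      exact ⟨l0, l1, h1, h2, h3, fun _ => h4, fun h => absurd h ha.not_gt, h5⟩
    · obtain ⟨l0, l1, h1, h2, h3, h4, h5⟩ :=
        StarGraph.spectrum_excited (b := a) (P := fun j : Fin N => ¬ j.val < K)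
          hp ha hα hsp hcp (fun j x => by rw [hV, ite_not]) (by simpa only [not_not] using hbal.symm)
          ⟨⟨K, hKN⟩, lt_irrefl K⟩
      rw [StarGraph.card_subtype_not_lt hKN] at h4
      exact ⟨l0, l1, h1, h2, h3, fun h => absurd h ha.not_gt, fun _ => h4, h5⟩
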